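/- Let $N,d\ge 2$ and let $X=(X_1,\dots,X_d)$ be locally Lipschitz vector fields on $\mathbb{R}^N$. Write $X\varphi=(X_1\varphi,\dots,X_d\varphi)$, where $X_j\varphi(x)=\nabla\varphi(x)\cdot X_j(x)$. A path $\gamma:[0,T]\to\mathbb{R}^N$ is subunit if it is absolutely continuous and, for a.e. $t$, $\dot\gamma(t)=\sum_j\theta_j(t)X_j(\gamma(t))$ with $\sum_j\theta_j(t)^2\le 1$; let $\delta(x,y)\in[0,\infty]$ be the infimum of the $T>0$ for which a subunit path $\gamma:[0,T]\to\mathbb{R}^N$ from $x$ to $y$ exists, and let $B_r(x)=\{y:\delta(x,y)<r\}$. Assume that: 1. for all $x$ and all sequences $(y_n)$ in $\mathbb{R}^N$, $|y_n-x|\to0$ if and only if $\delta(x,y_n)\to0$; 2. $0<|B_{2r}(x)|\le 2^Q|B_r(x)|$ for all $x\in\mathbb{R}^N$ and $r>0$, where $Q$ is a real constant and $|\cdot|$ is Lebesgue measure; 3. there are $C_P,\nu>0$ such that, writing $\langle w\rangle_B=\frac1{|B|}\int_B w\,dy$ for the mean value, $$\big\langle |u-\langle u\rangle_{B_r(x)}|\big\rangle_{B_r(x)}\le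 C_P\,r\,\langle |Xu|\rangle_{B_{\nu r}(x)}$$ for all $x\in\mathbb{R}^N$, all $r>0$ and all $u$ that are $C^1$ in a neighbourhood of $\overline{B_{\nu r}(x)}$ and for which $u$ is integrable on $B_r(x)$ and $Xu$ on $B_{\nu r}(x)$. Let $\Omega\subset\mathbb{R}^N$ be open and bounded, $1<p<Q$, $\alpha>0$, and $\frac{Q}{p-1}<m\le\infty$. Then there is a constant $C>0$, depending only on $Q,p,\Omega,\alpha,m,X$, with the following property. Let $a:\Omega\times\mathbb{R}\times\mathbb{R}^d\to\mathbb{R}^d$ be a Carathéodory function such that, for some $\beta>0$ and $h\in L^{p'}(\Omega)$, $p'=\frac p{p-1}$, for a.e. $x\in\Omega$, every $s\in\mathbb{R}$ and all $\xi\ne\eta$ in $\mathbb{R}^d$, $$a(x,s,\xi)\cdot\xi\ge\alpha|\xi|^p,\qquad |a(x,s,\xi)|\le\beta\big(h(x)+|s|^{p-1}+|\xi|^{p-1}\big),\qquad [a(x,s,\xi)-a(x,s,\eta)]\cdot(\xi-\eta)>0 .$$ Let $F\in (L^m(\Omega))^d$, and let $u\in W^{1,p}_0(\Omega,X)$ be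 a weak solution of $X^*a(x,u,Xu)=X^*F$ in $\Omega$, $u=0$ on $\partial\Omega$, that is, $$\int_\Omega a(x,u,Xu)\cdot Xv\,dx=\int_\Omega F\cdot Xv\,dx\qquad\text{for all }v\in W^{1,p}_0(\Omega,X).$$ Then $u\in L^\infty(\Omega)$ and $$\|u\|_{L^\infty(\Omega)}\le C\,\|F\|_{L^m(\Omega)}^{\frac1{p-1}} .$$ Here $W^{1,p}_0(\Omega,X)$ consists of the $u\in L^p(\Omega)$ for which there are $\varphi_n\in C_c^\infty(\Omega)$ and $Xu\in (L^p(\Omega))^d$ with $\varphi_n\to u$ in $L^p(\Omega)$ and $X\varphi_n\to Xu$ in $L^p(\Omega)$ ($Xu$ is then unique a.e.). -/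

import Mathlib

open MeasureTheory Filter Topology
open scoped ENNReal

noncomputable section

/-- The `X`-gradient `Xφ = (X₁φ, …, X_dφ)` of a differentiable function, where the vector field
`X j`, with components `c_{jk}`, acts as the operator `X_j φ = ∑ₖ c_{jk} ∂ₖφ`, i.e. as the
derivative of `φ` in the direction `X j x`. -/
def xGrad {N d : ℕ} (X : Fin d → EuclideanSpace ℝ (Fin N) → EuclideanSpace ℝ (Fin N))
    (φ : EuclideanSpace ℝ (Fin N) → ℝ) (x : EuclideanSpace ℝ (Fin N)) :
    EuclideanSpace ℝ (Fin d) :=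
  WithLp.toLp 2 fun j => fderiv ℝ φ x (X j x)

/-- `γ : [0, T] → ℝᴺ` is an `X`-subunit path: it is absolutely continuous and, for almost every
`t ∈ [0, T]`, `γ'(t) = ∑ⱼ θⱼ(t) Xⱼ(γ(t))` with `∑ⱼ θⱼ(t)² ≤ 1`. -/
def IsSubunitPath {N d : ℕ} (X : Fin d → EuclideanSpace ℝ (Fin N) → EuclideanSpace ℝ (Fin N))
    (T : ℝ) (γ : ℝ → EuclideanSpace ℝ (Fin N)) : Prop :=
  AbsolutelyContinuousOnInterval γ 0 T ∧
    ∀ᵐ t ∂(volume.restrict (Set.Icc 0 T)), ∃ θ : Fin d → ℝ,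
      ∑ j, θ j ^ 2 ≤ 1 ∧ HasDerivAt γ (∑ j, θ j • X j (γ t)) t

/-- The Carnot-Carathéodory (control) distance on `ℝᴺ`: the infimum of the times `T > 0` in which
an `X`-subunit path leads from `x` to `y` (and `∞` if there is none). -/
def ccDist {N d : ℕ} (X : Fin d → EuclideanSpace ℝ (Fin N) → EuclideanSpace ℝ (Fin N))
    (x y : EuclideanSpace ℝ (Fin N)) : ℝ≥0∞ :=
  ⨅ (T : ℝ) (γ : ℝ → EuclideanSpace ℝ (Fin N))
    (_ : 0 < T ∧ IsSubunitPath X T γ ∧ γ 0 = x ∧ γ T = y), ENNReal.ofReal T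

/-- The ball of center `x` and radius `r` of the control distance. -/
def ccBall {N d : ℕ} (X : Fin d → EuclideanSpace ℝ (Fin N) → EuclideanSpace ℝ (Fin N))
    (x : EuclideanSpace ℝ (Fin N)) (r : ℝ) : Set (EuclideanSpace ℝ (Fin N)) :=
  {y | ccDist X x y < ENNReal.ofReal r}

/-- `|y - x| → 0` if and only if the control distance of `x` and `y` tends to `0`. (As `ℝᴺ` is
connected, this forces the control distance to be finite.) -/
def CCTopologyEuclidean {N d : ℕ}
    (X : Fin d → EuclideanSpace ℝ (Fin N) → EuclideanSpace ℝ (Fin N)) : Prop :=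
  ∀ (x : EuclideanSpace ℝ (Fin N)) (y : ℕ → EuclideanSpace ℝ (Fin N)),
    Tendsto (fun n => ‖y n - x‖) atTop (𝓝 0) ↔ Tendsto (fun n => ccDist X x (y n)) atTop (𝓝 0)

/-- `ℝᴺ` with the control distance and the Lebesgue measure is doubling with exponent `Q`:
`0 < |B_{2r}| ≤ 2^Q |B_r|`. -/
def CCDoubling {N d : ℕ} (X : Fin d → EuclideanSpace ℝ (Fin N) → EuclideanSpace ℝ (Fin N))
    (Q : ℝ) : Prop :=
  ∀ (x : EuclideanSpace ℝ (Fin N)) (r : ℝ), 0 < r →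
    0 < volume (ccBall X x (2 * r)) ∧
      volume (ccBall X x (2 * r)) ≤ ENNReal.ofReal (2 ^ Q) * volume (ccBall X x r)

/-- The `(1,1)`-Poincaré inequality
`⨍_{B_r} |u - u_r| ≤ C_P r ⨍_{B_{νr}} |Xu|` on all balls of the control distance, for all `u` of
class `C¹` near the closure of `B_{νr}`. The two integrability conditions hold by themselves if
that closure is compact (and `ν ≥ 1`); otherwise they only discard functions for which the
integrals have no meaning. -/
def CCPoincare {N d : ℕ}
    (X : Fin d → EuclideanSpace ℝ (Fin N) → EuclideanSpace ℝ (Fin N)) : Prop :=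
  ∃ CP ν : ℝ, 0 < CP ∧ 0 < ν ∧
    ∀ (x : EuclideanSpace ℝ (Fin N)) (r : ℝ), 0 < r →
      ∀ (u : EuclideanSpace ℝ (Fin N) → ℝ) (U : Set (EuclideanSpace ℝ (Fin N))),
        IsOpen U → closure (ccBall X x (ν * r)) ⊆ U → ContDiffOn ℝ 1 u U →
        IntegrableOn u (ccBall X x r) → IntegrableOn (xGrad X u) (ccBall X x (ν * r)) →
        ⨍ y in ccBall X x r, |u y - ⨍ z in ccBall X x r, u z| ≤
          CP * r * ⨍ y in ccBall X x (ν * r), ‖xGrad X u y‖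

/-- `u ∈ W₀^{1,p}(Ω, X)` with `X`-gradient `Xu = g`: `u` is the limit of a sequence `φₙ` in
`C_c^∞(Ω)` whose `X`-gradients converge to `g` in `L^p(Ω)`. The function `g` is determined by `u`
up to null sets: it is the distributional `X`-gradient of `u`. -/
def IsSobolevZero {N d : ℕ} (X : Fin d → EuclideanSpace ℝ (Fin N) → EuclideanSpace ℝ (Fin N))
    (Ω : Set (EuclideanSpace ℝ (Fin N))) (p : ℝ)
    (u : EuclideanSpace ℝ (Fin N) → ℝ)
    (g : EuclideanSpace ℝ (Fin N) → EuclideanSpace ℝ (Fin d)) : Prop :=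
  MemLp u (ENNReal.ofReal p) (volume.restrict Ω) ∧
  MemLp g (ENNReal.ofReal p) (volume.restrict Ω) ∧
  ∃ φ : ℕ → EuclideanSpace ℝ (Fin N) → ℝ,
    (∀ n, ContDiff ℝ (⊤ : ℕ∞) (φ n) ∧ HasCompactSupport (φ n) ∧ tsupport (φ n) ⊆ Ω) ∧
    Tendsto (fun n => eLpNorm (fun x => φ n x - u x) (ENNReal.ofReal p) (volume.restrict Ω))
      atTop (𝓝 0) ∧
    Tendsto (fun n => eLpNorm (fun x => xGrad X (φ n) x - g x) (ENNReal.ofReal p)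
      (volume.restrict Ω)) atTop (𝓝 0)

/-- The assumptions on `a : Ω × ℝ × ℝᵈ → ℝᵈ`: it is a Carathéodory function, elliptic with
constant `α`, of growth `p - 1`, and strictly monotone in the last variable. -/
structure IsLerayLions {N d : ℕ} (Ω : Set (EuclideanSpace ℝ (Fin N))) (p α : ℝ)
    (a : EuclideanSpace ℝ (Fin N) → ℝ → EuclideanSpace ℝ (Fin d) → EuclideanSpace ℝ (Fin d)) :
    Prop where
  measurable : ∀ s ξ, AEStronglyMeasurable (fun x => a x s ξ) (volume.restrict Ω)
  continuous : ∀ᵐ x ∂(volume.restrict Ω),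
    Continuous fun q : ℝ × EuclideanSpace ℝ (Fin d) => a x q.1 q.2
  elliptic : ∀ᵐ x ∂(volume.restrict Ω), ∀ s ξ, α * ‖ξ‖ ^ p ≤ inner ℝ (a x s ξ) ξ
  growth : ∃ (β : ℝ) (h : EuclideanSpace ℝ (Fin N) → ℝ), 0 < β ∧
    MemLp h (ENNReal.ofReal (p / (p - 1))) (volume.restrict Ω) ∧
    ∀ᵐ x ∂(volume.restrict Ω), ∀ s ξ,
      ‖a x s ξ‖ ≤ β * (h x + |s| ^ (p - 1) + ‖ξ‖ ^ (p - 1))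
  monotone : ∀ᵐ x ∂(volume.restrict Ω), ∀ s ξ η, ξ ≠ η →
    0 < inner ℝ (a x s ξ - a x s η) (ξ - η)

/-- `u` is a weak solution of `X^* a(x, u, Xu) = X^* F` in `Ω`, `u = 0` on `∂Ω`. -/
def IsWeakSolution {N d : ℕ} (X : Fin d → EuclideanSpace ℝ (Fin N) → EuclideanSpace ℝ (Fin N))
    (Ω : Set (EuclideanSpace ℝ (Fin N))) (p : ℝ)
    (a : EuclideanSpace ℝ (Fin N) → ℝ → EuclideanSpace ℝ (Fin d) → EuclideanSpace ℝ (Fin d))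
    (F : EuclideanSpace ℝ (Fin N) → EuclideanSpace ℝ (Fin d))
    (u : EuclideanSpace ℝ (Fin N) → ℝ) : Prop :=
  ∃ g : EuclideanSpace ℝ (Fin N) → EuclideanSpace ℝ (Fin d), IsSobolevZero X Ω p u g ∧
    ∀ v w, IsSobolevZero X Ω p v w →
      ∫ x in Ω, inner ℝ (a x (u x) (g x)) (w x) = ∫ x in Ω, inner ℝ (F x) (w x)

end

/-! The proof is Stampacchia's level-set method, and the geometry enters only through a Faber-Krahn
inequality, `exists_faberKrahn`: ‖φ‖₁ ≤ C t^(1/Q) ‖Xφ‖₁ for test functions whose support has measure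
at most t ≤ T. Choose r so that every ball of radius r meeting Ω has measure at least 2t; iterating
doubling down from one large radius allows r ≲ t^(1/Q). On such a ball φ vanishes at least half of
the time, so the Poincaré inequality bounds the mean of |φ| itself. Integrating over all centres and
exchanging the integrals gives the global inequality: by doubling, the weights that appear are
bounded above and below, so no covering argument is needed.

Test the equation with H(u), where H is a truncation vanishing on [-l, l] and k < l. Ellipticity and
Hölder bound ∫|X(H(u))| by (‖F‖_m/α)^(1/(p-1)) f(k)^(1-1/(m(p-1))), where f(k) = |{|u| > k}|.
Faber-Krahn contributes a further f(k)^(1/Q), and Chebyshev yields (h-k) f(h) ≤ M f(k)^(1+σ) with σ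
= 1/Q - 1/(m(p-1)), which is positive because m > Q/(p-1). By `stampacchia`, f vanishes from a level
proportional to M on, hence to ‖F‖_m^(1/(p-1)). The growth bound on a serves only to make the
pairings integrable, so β and h do not enter the constant.

The truncations are smooth so that their compositions with the approximating test functions are
again test functions. -/

/-! ### Reparametrization of absolutely continuous curves. -/

/-- If the image intervals meet, each left end lies strictly below both right ends. A monotone map
reflects these strict inequalities, so the smaller of the original right ends lies in both original
intervals. -/
theorem disjoint_uIoc_of_monotone {ρ : ℝ → ℝ} (hρ : Monotone ρ) {a b c d : ℝ}
    (h : Disjoint (Set.uIoc a b) (Set.uIoc c d)) :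
    Disjoint (Set.uIoc (ρ a) (ρ b)) (Set.uIoc (ρ c) (ρ d)) := by
  rw [Set.disjoint_left] at h ⊢
  simp only [Set.uIoc, ← hρ.map_min, ← hρ.map_max, Set.mem_Ioc] at h ⊢
  rintro z ⟨h1, h2⟩ ⟨h3, h4⟩
  have h5 := hρ.reflect_lt (h1.trans_le h4)
  have h6 := hρ.reflect_lt (h3.trans_le h2)
  have h7 := hρ.reflect_lt (h1.trans_le h2)
  have h8 := hρ.reflect_lt (h3.trans_le h4)
  exact h (a := min (max a b) (max c d)) ⟨lt_min h7 h5, min_le_left _ _⟩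
    ⟨lt_min h6 h8, min_le_right _ _⟩

theorem disjoint_uIoc_of_antitone {ρ : ℝ → ℝ} (hρ : Antitone ρ) {a b c d : ℝ}
    (h : Disjoint (Set.uIoc a b) (Set.uIoc c d)) :
    Disjoint (Set.uIoc (ρ a) (ρ b)) (Set.uIoc (ρ c) (ρ d)) := by
  rw [Set.disjoint_left] at h ⊢
  simp only [Set.uIoc, ← hρ.map_min, ← hρ.map_max, Set.mem_Ioc] at h ⊢
  rintro z ⟨h1, h2⟩ ⟨h3, h4⟩
  have h5 := hρ.reflect_lt (h1.trans_le h4)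
  have h6 := hρ.reflect_lt (h3.trans_le h2)
  have h7 := hρ.reflect_lt (h1.trans_le h2)
  have h8 := hρ.reflect_lt (h3.trans_le h4)
  exact h (a := min (max a b) (max c d)) ⟨lt_min h7 h6, min_le_left _ _⟩
    ⟨lt_min h5 h8, min_le_right _ _⟩

/-- Monotonicity keeps disjoint intervals disjoint and nonexpansion does not increase their total
length, so the same δ works. This covers the reparametrizations used to reverse and join paths. -/
theorem AbsolutelyContinuousOnInterval.comp_of_nonexpanding {E : Type*} [PseudoMetricSpace E]
    {f : ℝ → E} {ρ : ℝ → ℝ} {a b c d : ℝ} (hf : AbsolutelyContinuousOnInterval f a b)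
    (hmon : Monotone ρ ∨ Antitone ρ) (hdist : ∀ s t, dist (ρ s) (ρ t) ≤ dist s t)
    (hmaps : Set.MapsTo ρ (Set.uIcc c d) (Set.uIcc a b)) :
    AbsolutelyContinuousOnInterval (fun t => f (ρ t)) c d := by
  rw [absolutelyContinuousOnInterval_iff] at hf ⊢
  intro ε hε
  obtain ⟨δ, hδ, H⟩ := hf ε hε
  refine ⟨δ, hδ, fun E hE hlen => ?_⟩
  refine H (E.1, fun i => (ρ (E.2 i).1, ρ (E.2 i).2)) ⟨fun i hi => ?_, fun i hi j hj hij => ?_⟩ ?_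
  · exact ⟨hmaps (hE.1 i hi).1, hmaps (hE.1 i hi).2⟩
  · rcases hmon with h | h
    · exact disjoint_uIoc_of_monotone h (hE.2 hi hj hij)
    · exact disjoint_uIoc_of_antitone h (hE.2 hi hj hij)
  · exact (Finset.sum_le_sum fun i _ => hdist _ _).trans_lt hlen

/-! ### The control distance: metric axioms, topology, volumes of balls. -/

section Metric

variable {N d : ℕ} {X : Fin d → EuclideanSpace ℝ (Fin N) → EuclideanSpace ℝ (Fin N)}

theorem IsSubunitPath.reverse {T : ℝ} (hT : 0 < T) {γ : ℝ → EuclideanSpace ℝ (Fin N)}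
    (h : IsSubunitPath X T γ) : IsSubunitPath X T (fun t => γ (T - t)) := by
  refine ⟨h.1.comp_of_nonexpanding (ρ := fun t => T - t)
    (Or.inr fun s t hst => sub_le_sub_left hst T)
    (fun s t => ?_) ?_, ?_⟩
  · rw [Real.dist_eq, Real.dist_eq, sub_sub_sub_cancel_left, abs_sub_comm]
  · intro t ht
    rw [Set.uIcc_of_le hT.le, Set.mem_Icc] at ht ⊢
    constructor <;> linarith [ht.1, ht.2]
  · have h2 := h.2
    rw [ae_restrict_iff' measurableSet_Icc] at h2 ⊢
    have h3 :=
      (Measure.measurePreserving_sub_left (volume : Measure ℝ) T).quasiMeasurePreserving.ae h2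
    filter_upwards [h3] with t ht htm
    obtain ⟨θ, hθ, hd⟩ := ht ⟨by linarith [htm.2], by linarith [htm.1]⟩
    refine ⟨fun j => -θ j, by simpa using hθ, ?_⟩
    have := hd.scomp t ((hasDerivAt_id t).const_sub T)
    simpa [Function.comp_def] using this

/-- Writing the joined path as a sum of two stopped paths, rather than piecewise, makes absolute
continuity immediate. Off the single time S one of the two summands is locally constant. -/
theorem IsSubunitPath.concat {S T : ℝ} (hS : 0 < S) (hT : 0 < T)
    {γ η : ℝ → EuclideanSpace ℝ (Fin N)} (h : IsSubunitPath X S γ) (h' : IsSubunitPath X T η)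
    (hγη : γ S = η 0) :
    IsSubunitPath X (S + T) (fun t => γ (min t S) + η (max (t - S) 0) - η 0) := by
  refine ⟨?_, ?_⟩
  · refine AbsolutelyContinuousOnInterval.fun_sub (AbsolutelyContinuousOnInterval.fun_add
      (h.1.comp_of_nonexpanding (ρ := fun t => min t S) (Or.inl ?_) ?_ ?_)
      (h'.1.comp_of_nonexpanding (ρ := fun t => max (t - S) 0) (Or.inl ?_) ?_ ?_)) ?_
    · intro s t hst; exact min_le_min_right _ hst
    · intro s t
      simpa [Real.dist_eq] using abs_min_sub_min_le_max s S t S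
    · intro t ht
      rw [Set.uIcc_of_le (by linarith), Set.mem_Icc] at ht ⊢
      exact ⟨le_min ht.1 hS.le, min_le_right _ _⟩
    · intro s t hst; exact max_le_max_right _ (by linarith)
    · intro s t
      simpa [Real.dist_eq] using abs_max_sub_max_le_max (s - S) 0 (t - S) 0
    · intro t ht
      rw [Set.uIcc_of_le (by linarith), Set.mem_Icc] at ht ⊢
      exact ⟨le_max_right _ _, max_le (by linarith [ht.2]) hT.le⟩
    · exact (LipschitzWith.const (η 0)).lipschitzOnWith.absolutelyContinuousOnInterval
  · have h1 := h.2
    have h2 := h'.2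
    rw [ae_restrict_iff' measurableSet_Icc] at h1 h2 ⊢
    have h3 := (measurePreserving_sub_right (volume : Measure ℝ) S).quasiMeasurePreserving.ae h2
    have h4 : ∀ᵐ t : ℝ, t ≠ S := by simp [ae_iff]
    filter_upwards [h1, h3, h4] with t ht1 ht2 hne htm
    rcases lt_or_gt_of_ne hne with hlt | hgt
    · obtain ⟨θ, hθ, hd⟩ := ht1 ⟨htm.1, hlt.le⟩
      refine ⟨θ, hθ, ?_⟩
      have e : (fun t => γ (min t S) + η (max (t - S) 0) - η 0) =ᶠ[𝓝 t] γ := by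
        filter_upwards [Iio_mem_nhds hlt] with s hs
        have : s - S ≤ 0 := by linarith [Set.mem_Iio.1 hs]
        simp [min_eq_left (le_of_lt (Set.mem_Iio.1 hs)), max_eq_right this]
      rw [e.eq_of_nhds]
      exact hd.congr_of_eventuallyEq e
    · obtain ⟨θ, hθ, hd⟩ := ht2 ⟨by linarith, by linarith [htm.2]⟩
      refine ⟨θ, hθ, ?_⟩
      have e : (fun t => γ (min t S) + η (max (t - S) 0) - η 0) =ᶠ[𝓝 t]
          fun t => η (t - S) := by
        filter_upwards [Ioi_mem_nhds hgt] with s hs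
        have : 0 ≤ s - S := by linarith [Set.mem_Ioi.1 hs]
        simp [min_eq_right (le_of_lt (Set.mem_Ioi.1 hs)), max_eq_left this, hγη]
      rw [e.eq_of_nhds]
      exact (hd.comp_sub_const t S).congr_of_eventuallyEq e

theorem ccDist_le {T : ℝ} (hT : 0 < T) {γ : ℝ → EuclideanSpace ℝ (Fin N)}
    (h : IsSubunitPath X T γ) : ccDist X (γ 0) (γ T) ≤ ENNReal.ofReal T :=
  iInf₂_le_of_le T γ (iInf_le_of_le ⟨hT, h, rfl, rfl⟩ le_rfl)

theorem ccDist_lt_iff {x y : EuclideanSpace ℝ (Fin N)} {r : ℝ≥0∞} :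
    ccDist X x y < r ↔ ∃ T γ, 0 < T ∧ IsSubunitPath X T γ ∧ γ 0 = x ∧ γ T = y ∧
      ENNReal.ofReal T < r := by
  simp only [ccDist, iInf_lt_iff]
  constructor
  · rintro ⟨T, γ, ⟨h1, h2, h3, h4⟩, h5⟩; exact ⟨T, γ, h1, h2, h3, h4, h5⟩
  · rintro ⟨T, γ, h1, h2, h3, h4, h5⟩; exact ⟨T, γ, ⟨h1, h2, h3, h4⟩, h5⟩

theorem ccDist_comm (x y : EuclideanSpace ℝ (Fin N)) : ccDist X x y = ccDist X y x := by
  suffices H : ∀ x y, ccDist X x y ≤ ccDist X y x from le_antisymm (H x y) (H y x)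
  intro x y
  refine le_of_forall_gt fun r hr => ?_
  obtain ⟨T, γ, hT, hγ, rfl, rfl, hTr⟩ := ccDist_lt_iff.1 hr
  refine lt_of_le_of_lt ?_ hTr
  simpa using ccDist_le hT (hγ.reverse hT)

theorem ccDist_triangle (x y z : EuclideanSpace ℝ (Fin N)) :
    ccDist X x z ≤ ccDist X x y + ccDist X y z := by
  by_cases h1 : ccDist X x y = ∞
  · simp [h1]
  by_cases h2 : ccDist X y z = ∞
  · simp [h2]
  refine ENNReal.le_of_forall_pos_le_add fun ε hε _ => ?_
  have hε' : ((ε / 2 : NNReal) : ℝ≥0∞) ≠ 0 := by simpa using hε.ne'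
  obtain ⟨S, γ, hS, hγ, hγ0, hγS, hSr⟩ := ccDist_lt_iff.1 (ENNReal.lt_add_right h1 hε')
  obtain ⟨T, η, hT, hη, hη0, hηT, hTr⟩ := ccDist_lt_iff.1 (ENNReal.lt_add_right h2 hε')
  have h := ccDist_le (by linarith) (hγ.concat hS hT hη (hγS.trans hη0.symm))
  simp only [min_eq_left hS.le, min_eq_right (show S ≤ S + T by linarith), zero_sub,
    add_sub_cancel_left, max_eq_left hT.le, max_eq_right (show -S ≤ 0 by linarith),
    hγ0, hγS, hη0, hηT, add_sub_cancel_right] at h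
  refine h.trans ?_
  rw [ENNReal.ofReal_add hS.le hT.le]
  refine (add_le_add hSr.le hTr.le).trans (le_of_eq ?_)
  rw [add_add_add_comm, ← ENNReal.coe_add, add_halves]

theorem mem_ccBall {x y : EuclideanSpace ℝ (Fin N)} {r : ℝ} :
    y ∈ ccBall X x r ↔ ccDist X x y < ENNReal.ofReal r := Iff.rfl

theorem mem_ccBall_comm {x y : EuclideanSpace ℝ (Fin N)} {r : ℝ} :
    y ∈ ccBall X x r ↔ x ∈ ccBall X y r := by
  rw [mem_ccBall, mem_ccBall, ccDist_comm]

theorem ccBall_subset_of_mem {x y : EuclideanSpace ℝ (Fin N)} {r : ℝ} (h : y ∈ ccBall X x r) :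
    ccBall X x r ⊆ ccBall X y (2 * r) := by
  intro z hz
  have hr : 0 < r := by
    by_contra hr
    simp [mem_ccBall, ENNReal.ofReal_of_nonpos (not_lt.1 hr)] at h
  rw [mem_ccBall, two_mul, ENNReal.ofReal_add hr.le hr.le]
  exact (ccDist_triangle y x z).trans_lt
    (ENNReal.add_lt_add (mem_ccBall.1 (mem_ccBall_comm.1 h)) hz)

theorem ccDist_self (hX : CCTopologyEuclidean X)
    (x : EuclideanSpace ℝ (Fin N)) : ccDist X x x = 0 := by
  have h := (hX x fun _ => x).1 (by simp)
  exact tendsto_nhds_unique tendsto_const_nhds h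

theorem tendsto_ccDist_nhds (hX : CCTopologyEuclidean X) (x : EuclideanSpace ℝ (Fin N)) :
    Tendsto (ccDist X x) (𝓝 x) (𝓝 0) := by
  rw [tendsto_iff_seq_tendsto]
  intro y hy
  exact (hX x y).1 (tendsto_iff_norm_sub_tendsto_zero.1 hy)

/-- Openness is needed jointly in both points: the exchange of integrals in `lintegral_ccBall_swap`
requires a measurable set of pairs. -/
theorem isOpen_ccDist_lt (hX : CCTopologyEuclidean X) (r : ℝ≥0∞) :
    IsOpen {q : EuclideanSpace ℝ (Fin N) × EuclideanSpace ℝ (Fin N) | ccDist X q.1 q.2 < r} := by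
  rw [isOpen_iff_mem_nhds]
  rintro ⟨x, y⟩ hxy
  have h1 := (tendsto_ccDist_nhds hX x).comp (tendsto_fst (g := 𝓝 y))
  have h2 := (tendsto_ccDist_nhds hX y).comp (tendsto_snd (f := 𝓝 x))
  have h3 : Tendsto (fun q : EuclideanSpace ℝ (Fin N) × EuclideanSpace ℝ (Fin N) =>
      ccDist X x q.1 + ccDist X x y + ccDist X y q.2) (𝓝 (x, y)) (𝓝 (0 + ccDist X x y + 0)) := by
    rw [nhds_prod_eq]
    exact (h1.add tendsto_const_nhds).add h2
  rw [zero_add, add_zero] at h3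
  filter_upwards [h3.eventually_lt_const hxy] with q hq
  refine lt_of_le_of_lt ?_ hq
  calc ccDist X q.1 q.2 ≤ ccDist X q.1 y + ccDist X y q.2 := ccDist_triangle _ _ _
    _ ≤ _ := by
      gcongr
      rw [ccDist_comm x q.1]
      exact ccDist_triangle _ _ _

theorem isOpen_ccBall (hX : CCTopologyEuclidean X)
    (x : EuclideanSpace ℝ (Fin N)) (r : ℝ) : IsOpen (ccBall X x r) :=
  (isOpen_ccDist_lt hX (ENNReal.ofReal r)).preimage (Continuous.prodMk_right x)

/-- The points at finite distance from x form a nonempty clopen subset of a connected space. -/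
theorem ccDist_lt_top (hX : CCTopologyEuclidean X)
    (x y : EuclideanSpace ℝ (Fin N)) : ccDist X x y < ∞ := by
  have ho : IsOpen {z | ccDist X x z < ∞} :=
    (isOpen_ccDist_lt hX ∞).preimage (Continuous.prodMk_right x)
  have hc : IsClosed {z | ccDist X x z < ∞} := by
    rw [← isOpen_compl_iff, isOpen_iff_mem_nhds]
    intro z hz
    filter_upwards [(tendsto_ccDist_nhds hX z).eventually_lt_const ENNReal.zero_lt_top] with w hw
    intro h
    refine hz ((ccDist_triangle x w z).trans_lt (ENNReal.add_lt_top.2 ⟨h, ?_⟩))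
    rwa [ccDist_comm]
  have := IsClopen.eq_univ ⟨hc, ho⟩ ⟨x, by simp [ccDist_self hX]⟩
  exact (Set.ext_iff.1 this y).2 (Set.mem_univ y)

theorem exists_subset_ccBall_of_isCompact (hX : CCTopologyEuclidean X)
    {K : Set (EuclideanSpace ℝ (Fin N))} (hK : IsCompact K) :
    ∃ R : ℝ, 0 < R ∧ ∀ x ∈ K, K ⊆ ccBall X x R := by
  obtain ⟨n, hn⟩ := hK.elim_directed_cover (fun n : ℕ => ccBall X 0 n)
    (fun n => isOpen_ccBall hX 0 n)
    (fun y _ => by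
      obtain ⟨n, hn⟩ := ENNReal.exists_nat_gt (ccDist_lt_top hX 0 y).ne
      exact Set.mem_iUnion.2 ⟨n, by simpa [mem_ccBall] using hn⟩)
    (directed_of_isDirected_le fun i j hij y hy =>
      lt_of_lt_of_le hy (ENNReal.ofReal_le_ofReal (by exact_mod_cast hij)))
  refine ⟨2 * (n + 1), by positivity, fun x hx => ?_⟩
  refine hn.trans ((ccBall_subset_of_mem (hn hx)).trans fun y hy => ?_)
  exact lt_of_lt_of_le hy (ENNReal.ofReal_le_ofReal (by linarith))

theorem exists_ccBall_subset_ball (hX : CCTopologyEuclidean X) (x : EuclideanSpace ℝ (Fin N)) :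
    ∃ n : ℕ, ccBall X x (2⁻¹ ^ n) ⊆ Metric.ball x 1 := by
  by_contra! h
  simp only [Set.not_subset] at h
  choose y hy hy' using h
  have h1 : Tendsto (fun n : ℕ => ENNReal.ofReal (2⁻¹ ^ n)) atTop (𝓝 0) := by
    rw [← ENNReal.ofReal_zero]
    exact ENNReal.tendsto_ofReal
      (tendsto_pow_atTop_nhds_zero_of_lt_one (by norm_num) (by norm_num))
  have h2 := (hX x y).2 (tendsto_of_tendsto_of_tendsto_of_le_of_le tendsto_const_nhds h1
    (fun _ => zero_le) fun n => (mem_ccBall.1 (hy n)).le)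
  obtain ⟨n, hn⟩ := (h2.eventually_lt_const one_pos).exists
  exact hy' n (by simpa [dist_eq_norm] using hn)

variable {Q : ℝ}

theorem volume_ccBall_pos (hQ : CCDoubling X Q)
    (x : EuclideanSpace ℝ (Fin N)) {r : ℝ} (hr : 0 < r) :
    0 < volume (ccBall X x r) := by
  have := (hQ x (r / 2) (by positivity)).1
  rwa [mul_div_cancel₀ r two_ne_zero] at this

theorem volume_ccBall_two_pow_le (hQ : CCDoubling X Q)
    (x : EuclideanSpace ℝ (Fin N)) {r : ℝ} (hr : 0 < r) (n : ℕ) :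
    volume (ccBall X x (2 ^ n * r)) ≤ ENNReal.ofReal (2 ^ Q) ^ n * volume (ccBall X x r) := by
  induction n with
  | zero => simp
  | succ n ih =>
    have := (hQ x (2 ^ n * r) (by positivity)).2
    rw [pow_succ', pow_succ', mul_assoc, mul_assoc]
    exact this.trans (by gcongr)

/-- Control balls are not known to be bounded. But a small one lies in a Euclidean ball, and
doubling carries finiteness to all radii. -/
theorem volume_ccBall_lt_top (hX : CCTopologyEuclidean X) (hQ : CCDoubling X Q)
    (x : EuclideanSpace ℝ (Fin N)) (r : ℝ) :
    volume (ccBall X x r) < ∞ := by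
  obtain ⟨n, hn⟩ := exists_ccBall_subset_ball hX x
  obtain ⟨k, hk⟩ := pow_unbounded_of_one_lt (r * 2 ^ n) one_lt_two
  have h1 := volume_ccBall_two_pow_le hQ x (show (0 : ℝ) < 2⁻¹ ^ n by positivity) k
  refine lt_of_le_of_lt (measure_mono fun y hy => ?_)
    (h1.trans_lt (ENNReal.mul_lt_top (by simp)
      ((measure_mono hn).trans_lt measure_ball_lt_top)))
  refine lt_of_lt_of_le hy (ENNReal.ofReal_le_ofReal ?_)
  rw [inv_pow, ← div_eq_mul_inv, le_div_iff₀ (by positivity)]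
  exact hk.le

end Metric

/-! ### From the Poincaré inequality to a Faber-Krahn inequality. -/

/-- On the zero set of f, at least half of B, the oscillation equals |c|. Hence |c| μ(B) ≤ 2 ∫|f -
c|, and the triangle inequality adds one more such integral. -/
theorem setAverage_abs_le_of_two_mul_measure_support_le {α : Type*} [MeasurableSpace α]
    {μ : Measure α} {B : Set α} (hB : MeasurableSet B) (hB0 : 0 < μ B) (hBt : μ B ≠ ∞)
    {f : α → ℝ} (hfm : Measurable f) (hf : IntegrableOn f B μ)
    (hsupp : 2 * μ (Function.support f) ≤ μ B) :
    ⨍ y in B, |f y| ∂μ ≤ 3 * ⨍ y in B, |f y - ⨍ z in B, f z ∂μ| ∂μ := by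
  set c := ⨍ z in B, f z ∂μ
  have hBr : 0 < μ.real B := ENNReal.toReal_pos hB0.ne' hBt
  have hc : IntegrableOn (fun _ => c) B μ := integrableOn_const hBt
  have hfc : IntegrableOn (fun y => |f y - c|) B μ := (hf.sub hc).abs
  have hS : MeasurableSet (Function.support f) := measurableSet_support hfm
  have hSt : μ (Function.support f) ≠ ∞ := by
    intro h
    rw [h, ENNReal.mul_top two_ne_zero] at hsupp
    exact hBt (top_le_iff.1 hsupp)
  have hZ : μ.real B / 2 ≤ μ.real (B \ Function.support f) := by
    have h1 : 2 * μ.real (Function.support f) ≤ μ.real B := by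
      simpa [Measure.real] using ENNReal.toReal_mono hBt hsupp
    have h2 := measureReal_sdiff_add_inter (μ := μ) (s := B) hS hBt
    have h3 : μ.real (B ∩ Function.support f) ≤ μ.real (Function.support f) :=
      measureReal_mono Set.inter_subset_right hSt
    linarith
  have h4 : |c| * μ.real (B \ Function.support f) ≤ ∫ y in B, |f y - c| ∂μ := by
    calc |c| * μ.real (B \ Function.support f)
        = ∫ y in B \ Function.support f, |f y - c| ∂μ := by
          rw [setIntegral_congr_fun (g := fun _ => |c|) (hB.diff hS)]
          · simp [mul_comm]
          · intro y hy
            have : f y = 0 := by simpa using hy.2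
            simp [this]
      _ ≤ _ := setIntegral_mono_set hfc (ae_of_all _ fun y => abs_nonneg _)
        (LE.le.eventuallyLE Set.sdiff_subset)
  have h5 : ∫ y in B, |f y| ∂μ ≤ ∫ y in B, |f y - c| ∂μ + |c| * μ.real B := by
    calc ∫ y in B, |f y| ∂μ ≤ ∫ y in B, (|f y - c| + |c|) ∂μ := by
          refine integral_mono hf.abs (hfc.add hc.abs) fun y => ?_
          simpa using abs_add_le (f y - c) c
      _ = _ := by
          rw [integral_add hfc hc.abs]
          simp [mul_comm]
  have h6 : |c| * μ.real B ≤ 2 * ∫ y in B, |f y - c| ∂μ := by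
    nlinarith [abs_nonneg c]
  simp only [setAverage_eq, smul_eq_mul]
  rw [mul_left_comm]
  exact mul_le_mul_of_nonneg_left (by linarith) (by positivity)

section Gradient

variable {N d : ℕ} {X : Fin d → EuclideanSpace ℝ (Fin N) → EuclideanSpace ℝ (Fin N)}

theorem continuous_xGrad (hX : ∀ j, Continuous (X j)) {φ : EuclideanSpace ℝ (Fin N) → ℝ}
    (hφ : ContDiff ℝ 1 φ) : Continuous (xGrad X φ) := by
  refine (PiLp.continuous_toLp 2 _).comp (continuous_pi fun j => ?_)
  exact (hφ.continuous_fderiv one_ne_zero).clm_apply (hX j)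

theorem support_xGrad_subset (φ : EuclideanSpace ℝ (Fin N) → ℝ) :
    Function.support (xGrad X φ) ⊆ tsupport φ := by
  intro x hx
  by_contra h
  refine hx ?_
  have : fderiv ℝ φ x = 0 := by
    by_contra h'
    exact h (support_fderiv_subset ℝ h')
  ext j
  simp [xGrad, this]

theorem hasCompactSupport_xGrad {φ : EuclideanSpace ℝ (Fin N) → ℝ}
    (hφ : HasCompactSupport φ) : HasCompactSupport (xGrad X φ) :=
  hφ.mono' (support_xGrad_subset φ)

theorem ofReal_setAverage_norm {E α : Type*} [NormedAddCommGroup E] [MeasurableSpace α]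
    {μ : Measure α} {B : Set α} (hB0 : 0 < μ B) {f : α → E} (hf : IntegrableOn f B μ) :
    ENNReal.ofReal (⨍ y in B, ‖f y‖ ∂μ) = (μ B)⁻¹ * ∫⁻ y in B, ‖f y‖ₑ ∂μ := by
  by_cases hBt : μ B = ∞
  · simp [setAverage_eq, measureReal_def, hBt]
  rw [setAverage_eq, smul_eq_mul, ENNReal.ofReal_mul (by positivity),
    ofReal_integral_norm_eq_lintegral_enorm hf, ENNReal.ofReal_inv_of_pos
    (show 0 < μ.real B from ENNReal.toReal_pos hB0.ne' hBt), ofReal_measureReal hBt]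

variable {Q : ℝ}

theorem lintegral_ccBall_enorm_le (hXc : ∀ j, Continuous (X j)) (hX : CCTopologyEuclidean X)
    (hQ : CCDoubling X Q) {CP ν : ℝ} (hCP : 0 < CP) (hν : 0 < ν)
    (hP : ∀ (x : EuclideanSpace ℝ (Fin N)) (r : ℝ), 0 < r →
      ∀ (u : EuclideanSpace ℝ (Fin N) → ℝ) (U : Set (EuclideanSpace ℝ (Fin N))),
        IsOpen U → closure (ccBall X x (ν * r)) ⊆ U → ContDiffOn ℝ 1 u U →
        IntegrableOn u (ccBall X x r) → IntegrableOn (xGrad X u) (ccBall X x (ν * r)) →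
        ⨍ y in ccBall X x r, |u y - ⨍ z in ccBall X x r, u z| ≤
          CP * r * ⨍ y in ccBall X x (ν * r), ‖xGrad X u y‖)
    {φ : EuclideanSpace ℝ (Fin N) → ℝ} (hφ : ContDiff ℝ 1 φ) (hφc : HasCompactSupport φ)
    (x : EuclideanSpace ℝ (Fin N)) {r : ℝ} (hr : 0 < r)
    (hsupp : 2 * volume (Function.support φ) ≤ volume (ccBall X x r)) :
    (volume (ccBall X x r))⁻¹ * ∫⁻ y in ccBall X x r, ‖φ y‖ₑ ≤
      ENNReal.ofReal (3 * CP * r) *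
        ((volume (ccBall X x (ν * r)))⁻¹ * ∫⁻ y in ccBall X x (ν * r), ‖xGrad X φ y‖ₑ) := by
  have hi : Integrable φ := hφ.continuous.integrable_of_hasCompactSupport hφc
  have hig : Integrable (xGrad X φ) :=
    (continuous_xGrad hXc hφ).integrable_of_hasCompactSupport (hasCompactSupport_xGrad hφc)
  rw [← ofReal_setAverage_norm (volume_ccBall_pos hQ x hr) hi.integrableOn,
    ← ofReal_setAverage_norm (volume_ccBall_pos hQ x (by positivity)) hig.integrableOn,
    ← ENNReal.ofReal_mul (by positivity)]
  refine ENNReal.ofReal_le_ofReal ?_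
  have h1 := setAverage_abs_le_of_two_mul_measure_support_le (isOpen_ccBall hX x r).measurableSet
    (volume_ccBall_pos hQ x hr) (volume_ccBall_lt_top hX hQ x r).ne hφ.continuous.measurable
    hi.integrableOn hsupp
  have h2 := hP x r hr φ Set.univ isOpen_univ (Set.subset_univ _) hφ.contDiffOn
    hi.integrableOn hig.integrableOn
  simp only [Real.norm_eq_abs] at h1 ⊢
  linarith

theorem measurable_volume_ccBall (hX : CCTopologyEuclidean X) (r : ℝ) :
    Measurable fun x => volume (ccBall X x r) :=
  measurable_measure_prodMk_left (isOpen_ccDist_lt hX (ENNReal.ofReal r)).measurableSet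

/-- Tonelli, together with the symmetry of the distance: the centres whose ball contains y form the
ball around y. -/
theorem lintegral_ccBall_swap (hX : CCTopologyEuclidean X) (r : ℝ)
    {f : EuclideanSpace ℝ (Fin N) → ℝ≥0∞} (hf : Measurable f) :
    ∫⁻ x, (volume (ccBall X x r))⁻¹ * ∫⁻ y in ccBall X x r, f y =
      ∫⁻ y, f y * ∫⁻ x in ccBall X y r, (volume (ccBall X x r))⁻¹ := by
  have hw : Measurable fun x => (volume (ccBall X x r))⁻¹ := (measurable_volume_ccBall hX r).inv
  have hS := (isOpen_ccDist_lt hX (ENNReal.ofReal r)).measurableSet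
  have hm : Measurable fun q : EuclideanSpace ℝ (Fin N) × EuclideanSpace ℝ (Fin N) =>
      {q | ccDist X q.1 q.2 < ENNReal.ofReal r}.indicator
        (fun q => (volume (ccBall X q.1 r))⁻¹ * f q.2) q :=
    ((hw.comp measurable_fst).mul (hf.comp measurable_snd)).indicator hS
  have h := lintegral_lintegral_swap (μ := volume) (ν := volume)
    (f := fun x y => {q : EuclideanSpace ℝ (Fin N) × EuclideanSpace ℝ (Fin N) |
      ccDist X q.1 q.2 < ENNReal.ofReal r}.indicator
        (fun q => (volume (ccBall X q.1 r))⁻¹ * f q.2) (x, y)) hm.aemeasurable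
  calc _ = _ := ?_
    _ = _ := h
    _ = _ := ?_
  · refine lintegral_congr fun x => ?_
    rw [← lintegral_const_mul _ hf, ← lintegral_indicator (isOpen_ccBall hX x r).measurableSet]
    rfl
  · refine lintegral_congr fun y => ?_
    rw [← lintegral_const_mul _ hw, ← lintegral_indicator (isOpen_ccBall hX y r).measurableSet]
    refine lintegral_congr fun x => ?_
    have : (x ∈ ccBall X y r) = (ccDist X x y < ENNReal.ofReal r) :=
      propext mem_ccBall_comm
    simp only [Set.indicator, Set.mem_ofPred_eq, this, mul_comm]

theorem volume_ccBall_le_of_mem (hQ : CCDoubling X Q) {x y : EuclideanSpace ℝ (Fin N)} {r : ℝ}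
    (hr : 0 < r) (h : y ∈ ccBall X x r) :
    volume (ccBall X x r) ≤ ENNReal.ofReal (2 ^ Q) * volume (ccBall X y r) :=
  (measure_mono (ccBall_subset_of_mem h)).trans (hQ y r hr).2

/-- Balls of equal radius, each containing the other's centre, have comparable volumes by doubling.
With the matching lower bound below, the weight left by the exchange of integrals is comparable to
1. -/
theorem lintegral_inv_volume_ccBall_le (hX : CCTopologyEuclidean X) (hQ : CCDoubling X Q)
    (y : EuclideanSpace ℝ (Fin N)) {r : ℝ} (hr : 0 < r) :
    ∫⁻ x in ccBall X y r, (volume (ccBall X x r))⁻¹ ≤ ENNReal.ofReal (2 ^ Q) := by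
  have hV0 := (volume_ccBall_pos hQ y hr).ne'
  have hVt := (volume_ccBall_lt_top hX hQ y r).ne
  have hc0 : ENNReal.ofReal (2 ^ Q) ≠ 0 := by simp; positivity
  calc ∫⁻ x in ccBall X y r, (volume (ccBall X x r))⁻¹
      ≤ ∫⁻ _ in ccBall X y r, ENNReal.ofReal (2 ^ Q) * (volume (ccBall X y r))⁻¹ := by
        refine setLIntegral_mono' (isOpen_ccBall hX y r).measurableSet fun x hx => ?_
        rw [← ENNReal.inv_le_inv, inv_inv, ENNReal.mul_inv (Or.inl hc0) (Or.inl (by simp)),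
          inv_inv, mul_comm, ← div_eq_mul_inv]
        exact ENNReal.div_le_of_le_mul' (volume_ccBall_le_of_mem hQ hr hx)
    _ = _ := by
        rw [setLIntegral_const, mul_assoc, ENNReal.inv_mul_cancel hV0 hVt, mul_one]

theorem le_lintegral_inv_volume_ccBall (hX : CCTopologyEuclidean X) (hQ : CCDoubling X Q)
    (y : EuclideanSpace ℝ (Fin N)) {r : ℝ} (hr : 0 < r) :
    1 ≤ ENNReal.ofReal (2 ^ Q) * ∫⁻ x in ccBall X y r, (volume (ccBall X x r))⁻¹ := by
  have hV0 := (volume_ccBall_pos hQ y hr).ne'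
  have hVt := (volume_ccBall_lt_top hX hQ y r).ne
  have hc0 : ENNReal.ofReal (2 ^ Q) ≠ 0 := by simp; positivity
  have hw : Measurable fun x => (volume (ccBall X x r))⁻¹ := (measurable_volume_ccBall hX r).inv
  rw [← lintegral_const_mul _ hw]
  calc (1 : ℝ≥0∞) = ∫⁻ _ in ccBall X y r, (volume (ccBall X y r))⁻¹ := by
        rw [setLIntegral_const, ENNReal.inv_mul_cancel hV0 hVt]
    _ ≤ _ := by
        refine setLIntegral_mono' (isOpen_ccBall hX y r).measurableSet fun x hx => ?_
        have h := ENNReal.inv_le_inv.2 (volume_ccBall_le_of_mem hQ hr (mem_ccBall_comm.1 hx))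
        rw [ENNReal.mul_inv (Or.inl hc0) (Or.inl (by simp))] at h
        calc (volume (ccBall X y r))⁻¹
            = ENNReal.ofReal (2 ^ Q) * ((ENNReal.ofReal (2 ^ Q))⁻¹ *
              (volume (ccBall X y r))⁻¹) := by
              rw [← mul_assoc, ENNReal.mul_inv_cancel hc0 (by simp), one_mul]
          _ ≤ _ := by gcongr

/-- If a ball of radius `r` is at least twice as large as the support of `φ` whenever it meets
that support, the Poincaré inequalities on these balls add up to a global one. -/
theorem lintegral_enorm_le_of_forall_ccBall (hX : CCTopologyEuclidean X) (hQ : CCDoubling X Q)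
    {f g : EuclideanSpace ℝ (Fin N) → ℝ≥0∞} (hf : Measurable f) (hg : Measurable g)
    {r s : ℝ} (hr : 0 < r) (hs : 0 < s) {c : ℝ≥0∞} (hc : c ≠ ∞)
    (h : ∀ x, (volume (ccBall X x r))⁻¹ * ∫⁻ y in ccBall X x r, f y ≤
      c * ((volume (ccBall X x s))⁻¹ * ∫⁻ y in ccBall X x s, g y)) :
    ∫⁻ y, f y ≤ ENNReal.ofReal (2 ^ Q) * ENNReal.ofReal (2 ^ Q) * c * ∫⁻ y, g y := by
  set D := ENNReal.ofReal (2 ^ Q)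
  have hDt : D ≠ ∞ := ENNReal.ofReal_ne_top
  calc ∫⁻ y, f y
      ≤ ∫⁻ y, D * (f y * ∫⁻ x in ccBall X y r, (volume (ccBall X x r))⁻¹) := by
        refine lintegral_mono fun y => ?_
        rw [mul_left_comm]
        exact le_mul_of_one_le_right' (le_lintegral_inv_volume_ccBall hX hQ y hr)
    _ = D * ∫⁻ x, (volume (ccBall X x r))⁻¹ * ∫⁻ y in ccBall X x r, f y := by
        rw [lintegral_const_mul' _ _ hDt, lintegral_ccBall_swap hX r hf]
    _ ≤ D * ∫⁻ x, c * ((volume (ccBall X x s))⁻¹ * ∫⁻ y in ccBall X x s, g y) := by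
        exact mul_le_mul_right (lintegral_mono h) D
    _ = D * (c * ∫⁻ y, g y * ∫⁻ x in ccBall X y s, (volume (ccBall X x s))⁻¹) := by
        rw [lintegral_const_mul' _ _ hc, lintegral_ccBall_swap hX s hg]
    _ ≤ D * (c * ∫⁻ y, g y * D) := by
        gcongr with y
        exact lintegral_inv_volume_ccBall_le hX hQ y hs
    _ = _ := by
        rw [lintegral_mul_const' _ _ hDt]
        ring

/-- A large closed Euclidean ball containing Ω is compact, hence contained in a control ball of one
common radius around each of its points. -/
theorem exists_ccBall_volume_ge (hN : 0 < N) (hX : CCTopologyEuclidean X)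
    {Ω : Set (EuclideanSpace ℝ (Fin N))} (hΩb : Bornology.IsBounded Ω) (T : ℝ) :
    ∃ R V : ℝ, 0 < R ∧ T ≤ V ∧ 0 < V ∧
      ∀ x ∈ Ω, ENNReal.ofReal V ≤ volume (ccBall X x R) := by
  have : Nonempty (Fin N) := ⟨⟨0, hN⟩⟩
  obtain ⟨ρ₀, hρ₀⟩ := hΩb.subset_closedBall 0
  have h1 : Tendsto (fun n : ℕ => volume (Metric.closedBall (0 : EuclideanSpace ℝ (Fin N)) n))
      atTop (𝓝 ∞) := by
    have := tendsto_measure_iUnion_atTop (μ := volume)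
      (s := fun n : ℕ => Metric.closedBall (0 : EuclideanSpace ℝ (Fin N)) n)
      (fun i j hij => Metric.closedBall_subset_closedBall (by exact_mod_cast hij))
    rwa [Metric.iUnion_closedBall_nat, measure_univ_of_isAddLeftInvariant] at this
  obtain ⟨n, hn1, hn2⟩ := ((h1.eventually_const_lt
    (show ENNReal.ofReal (max T 1) < ∞ from ENNReal.ofReal_lt_top)).and
    (tendsto_natCast_atTop_atTop.eventually_ge_atTop ρ₀)).exists
  obtain ⟨R, hR, hR'⟩ := exists_subset_ccBall_of_isCompact hX
    (isCompact_closedBall (0 : EuclideanSpace ℝ (Fin N)) n)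
  exact ⟨R, max T 1, hR, le_max_left _ _, by positivity, fun x hx =>
    hn1.le.trans (measure_mono (hR' x (Metric.closedBall_subset_closedBall hn2 (hρ₀ hx))))⟩

theorem exists_radius_two_mul_le_volume_ccBall (hN : 0 < N) (hX : CCTopologyEuclidean X)
    (hQ : CCDoubling X Q) (hQ0 : 0 < Q)
    {Ω : Set (EuclideanSpace ℝ (Fin N))} (hΩb : Bornology.IsBounded Ω) (T : ℝ) :
    ∃ C : ℝ, 0 < C ∧ ∀ t, 0 < t → t ≤ T → ∃ r, 0 < r ∧ r ≤ C * t ^ (1 / Q) ∧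
      ∀ x y, y ∈ Ω → y ∈ ccBall X x r → 2 * ENNReal.ofReal t ≤ volume (ccBall X x r) := by
  -- This size of V makes 2Dt/V ≤ 1 for every t ≤ T, with D = 2^Q, so a dyadic scale n ≥ 0 can be
  -- chosen below.
  obtain ⟨R, V, hR, hTV, hV, H⟩ := exists_ccBall_volume_ge hN hX hΩb (2 * 2 ^ Q * T)
  have hD : (0 : ℝ) < 2 ^ Q := by positivity
  have hD1 : (1 : ℝ) < 2 ^ Q := Real.one_lt_rpow one_lt_two hQ0
  set D : ℝ := 2 ^ Q with hDdef
  refine ⟨R * 2 * (2 * D / V) ^ (1 / Q), by positivity, fun t ht htT => ?_⟩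
  have hx1 : 2 * D * t / V ≤ 1 := by
    rw [div_le_one hV]
    exact (mul_le_mul_of_nonneg_left htT (by positivity)).trans hTV
  -- The scale satisfies D^(-n-1) < 2Dt/V ≤ D^(-n). As D = 2^Q, the left inequality bounds the
  -- radius by a multiple of t^(1/Q). The right one gives the volume bound, after n doublings from
  -- 2⁻ⁿR to R and one more to move the centre from y to x.
  obtain ⟨n, hn1, hn2⟩ := exists_nat_pow_near_of_lt_one (show 0 < 2 * D * t / V by positivity) hx1
    (inv_pos.2 hD) (inv_lt_one_of_one_lt₀ hD1)
  have hpow : ∀ k : ℕ, D⁻¹ ^ k = ((2⁻¹ : ℝ) ^ k) ^ Q := by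
    intro k
    rw [hDdef, ← Real.inv_rpow zero_le_two, ← Real.rpow_natCast, ← Real.rpow_natCast,
      ← Real.rpow_mul (by norm_num), ← Real.rpow_mul (by norm_num), mul_comm]
  refine ⟨2⁻¹ ^ n * R, by positivity, ?_, fun x y hy hyx => ?_⟩
  · have h1 : (2⁻¹ : ℝ) ^ (n + 1) ≤ (2 * D * t / V) ^ (1 / Q) := by
      rw [one_div, Real.le_rpow_inv_iff_of_pos (by positivity) (by positivity) hQ0, ← hpow]
      exact hn1.le
    rw [pow_succ, show 2 * D * t / V = 2 * D / V * t by ring,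
      Real.mul_rpow (by positivity) ht.le] at h1
    nlinarith
  · have h1 := volume_ccBall_two_pow_le hQ y (show 0 < 2⁻¹ ^ n * R by positivity) n
    rw [← mul_assoc, ← mul_pow, mul_inv_cancel₀ two_ne_zero, one_pow, one_mul] at h1
    have h2 := volume_ccBall_le_of_mem hQ (by positivity) (mem_ccBall_comm.1 hyx)
    have h3 : ENNReal.ofReal V ≤ ENNReal.ofReal D ^ n * (ENNReal.ofReal D *
        volume (ccBall X x (2⁻¹ ^ n * R))) := (H y hy).trans (h1.trans (by gcongr))
    have hvt := (volume_ccBall_lt_top hX hQ x (2⁻¹ ^ n * R)).ne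
    rw [← ENNReal.ofReal_toReal hvt, ← ENNReal.ofReal_pow hD.le, ← ENNReal.ofReal_mul hD.le,
      ← ENNReal.ofReal_mul (by positivity), ENNReal.ofReal_le_ofReal_iff (by positivity)] at h3
    rw [two_mul, ← ENNReal.ofReal_add ht.le ht.le, ← two_mul]
    refine ENNReal.ofReal_le_of_le_toReal ?_
    rw [inv_pow, div_le_iff₀ hV, inv_mul_eq_div, le_div_iff₀ (by positivity)] at hn2
    have h4 : D * (D ^ n * (2 * t)) ≤
        D * (D ^ n * (volume (ccBall X x (2⁻¹ ^ n * R))).toReal) := by linarith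
    exact le_of_mul_le_mul_left (le_of_mul_le_mul_left h4 hD) (by positivity)

/-- A Faber-Krahn inequality with exponent `Q`: a function supported in a set of measure at most
`t` is controlled by its `X`-gradient with constant `C t^(1/Q)`. -/
theorem exists_faberKrahn (hN : 0 < N) (hXc : ∀ j, Continuous (X j)) (hX : CCTopologyEuclidean X)
    (hQ : CCDoubling X Q) (hQ0 : 0 < Q) (hP : CCPoincare X)
    {Ω : Set (EuclideanSpace ℝ (Fin N))} (hΩb : Bornology.IsBounded Ω) (T : ℝ) :
    ∃ C : ℝ, 0 < C ∧ ∀ φ : EuclideanSpace ℝ (Fin N) → ℝ, ContDiff ℝ 1 φ → HasCompactSupport φ →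
      tsupport φ ⊆ Ω → ∀ t, 0 < t → t ≤ T →
      volume (Function.support φ) ≤ ENNReal.ofReal t →
      ∫⁻ x, ‖φ x‖ₑ ≤ ENNReal.ofReal (C * t ^ (1 / Q)) * ∫⁻ x, ‖xGrad X φ x‖ₑ := by
  obtain ⟨CP, ν, hCP, hν, hP⟩ := hP
  obtain ⟨C, hC, H⟩ := exists_radius_two_mul_le_volume_ccBall hN hX hQ hQ0 hΩb T
  refine ⟨2 ^ Q * 2 ^ Q * (3 * CP * C), by positivity, fun φ hφ hφc hφΩ t ht htT hvol => ?_⟩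
  obtain ⟨r, hr, hrt, hr'⟩ := H t ht htT
  have h := lintegral_enorm_le_of_forall_ccBall hX hQ (f := fun x => ‖φ x‖ₑ)
    (g := fun x => ‖xGrad X φ x‖ₑ) hφ.continuous.enorm.measurable
    (continuous_xGrad hXc hφ).enorm.measurable hr (mul_pos hν hr)
    (c := ENNReal.ofReal (3 * CP * r)) ENNReal.ofReal_ne_top (fun x => ?_)
  · refine h.trans ?_
    gcongr
    rw [← ENNReal.ofReal_mul (by positivity), ← ENNReal.ofReal_mul (by positivity)]
    refine ENNReal.ofReal_le_ofReal ?_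
    calc 2 ^ Q * 2 ^ Q * (3 * CP * r) ≤ 2 ^ Q * 2 ^ Q * (3 * CP * (C * t ^ (1 / Q))) := by
          gcongr
      _ = _ := by ring
  -- Balls that miss Ω may be too small for the volume condition, but φ vanishes on them.
  · by_cases hx : ∃ y ∈ Ω, y ∈ ccBall X x r
    · obtain ⟨y, hy, hyx⟩ := hx
      exact lintegral_ccBall_enorm_le hXc hX hQ hCP hν hP hφ hφc x hr
        ((mul_le_mul_right hvol 2).trans (hr' x y hy hyx))
    · push Not at hx
      rw [setLIntegral_congr_fun (g := fun _ => 0) (isOpen_ccBall hX x r).measurableSet]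
      · simp
      · intro y hy
        have : φ y = 0 := by
          by_contra h0
          exact hx y (hφΩ (subset_tsupport _ h0)) hy
        simp [this]

end Gradient

/-! ### Smooth truncations. -/

theorem hasDerivAt_mul_expNegInvGlue (s : ℝ) :
    HasDerivAt (fun t => t * expNegInvGlue t) ((1 + s⁻¹) * expNegInvGlue s) s := by
  have h1 := expNegInvGlue.hasDerivAt_polynomial_eval_inv_mul 1 s
  simp only [Polynomial.eval_one, one_mul, Polynomial.derivative_one, sub_zero, mul_one,
    Polynomial.eval_pow, Polynomial.eval_X] at h1
  refine ((hasDerivAt_id' s).fun_mul h1).congr_deriv ?_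
  rcases eq_or_ne s 0 with rfl | hs
  · simp
  · field_simp

/-- For s > 0 the upper bound is 1 + x ≤ exp x at x = 1/s. -/
theorem deriv_mul_expNegInvGlue_mem_Icc (s : ℝ) :
    (1 + s⁻¹) * expNegInvGlue s ∈ Set.Icc (0 : ℝ) 1 := by
  rcases le_or_gt s 0 with hs | hs
  · simp [expNegInvGlue.zero_of_nonpos hs]
  · have : 0 < s⁻¹ := inv_pos.2 hs
    refine ⟨mul_nonneg (by linarith) (expNegInvGlue.nonneg s), ?_⟩
    rw [expNegInvGlue, if_neg (not_le.2 hs), Real.exp_neg, ← div_eq_mul_inv,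
      div_le_one (Real.exp_pos _), add_comm]
    exact Real.add_one_le_exp _

theorem sub_one_le_mul_expNegInvGlue (s : ℝ) : s - 1 ≤ s * expNegInvGlue s := by
  rcases le_or_gt s 0 with hs | hs
  · rw [expNegInvGlue.zero_of_nonpos hs]
    linarith
  · rw [expNegInvGlue, if_neg (not_le.2 hs)]
    have := mul_le_mul_of_nonneg_left (Real.add_one_le_exp (-s⁻¹)) hs.le
    rw [mul_add, mul_neg, mul_inv_cancel₀ hs.ne'] at this
    linarith

/-- A smooth nondecreasing nonexpanding function which vanishes on `[-k, k]` and grows at least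
like `|s| - k - ε`. -/
structure IsSmoothTruncation (H : ℝ → ℝ) (k ε : ℝ) : Prop where
  contDiff : ContDiff ℝ (⊤ : ℕ∞) H
  deriv_nonneg : ∀ s, 0 ≤ deriv H s
  deriv_le_one : ∀ s, deriv H s ≤ 1
  eq_zero : ∀ s, |s| ≤ k → H s = 0
  deriv_eq_zero : ∀ s, |s| ≤ k → deriv H s = 0
  sub_le : ∀ s, |s| - k - ε ≤ |H s|

theorem exists_isSmoothTruncation {k ε : ℝ} (hk : 0 ≤ k) (hε : 0 < ε) :
    ∃ H, IsSmoothTruncation H k ε := by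
  -- For t > 0, η(t) = t exp(-1/t) has slope in [0, 1] and stays above t - 1. Rescaling by ε keeps
  -- the slope and shrinks the loss to ε. Since k ≥ 0, the two reflected pieces never act at the
  -- same point.
  set η : ℝ → ℝ := fun t => t * expNegInvGlue t with hη
  set η' : ℝ → ℝ := fun t => (1 + t⁻¹) * expNegInvGlue t with hη'
  have hη0 : ∀ s ≤ 0, η s = 0 := fun s hs => by simp [hη, expNegInvGlue.zero_of_nonpos hs]
  have hη'0 : ∀ s ≤ 0, η' s = 0 := fun s hs => by simp [hη', expNegInvGlue.zero_of_nonpos hs]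
  have hsmooth : ContDiff ℝ (⊤ : ℕ∞) η := contDiff_id.mul expNegInvGlue.contDiff
  have hd : ∀ s, HasDerivAt (fun s => ε * η ((s - k) / ε) - ε * η ((-s - k) / ε))
      (η' ((s - k) / ε) + η' ((-s - k) / ε)) s := by
    intro s
    have h1 := (((hasDerivAt_mul_expNegInvGlue ((s - k) / ε)).comp s
      (((hasDerivAt_id s).sub_const k).div_const ε)).const_mul ε).sub
      (((hasDerivAt_mul_expNegInvGlue ((-s - k) / ε)).comp s
      (((hasDerivAt_id s).neg.sub_const k).div_const ε)).const_mul ε)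
    refine h1.congr_deriv ?_
    simp only [hη']
    field_simp
    ring
  have hneg : ∀ s, |s| ≤ k → (s - k) / ε ≤ 0 ∧ (-s - k) / ε ≤ 0 := fun s hs =>
    ⟨div_nonpos_of_nonpos_of_nonneg (by linarith [le_abs_self s]) hε.le,
      div_nonpos_of_nonpos_of_nonneg (by linarith [neg_le_abs s]) hε.le⟩
  have hge : ∀ s, s - k - ε ≤ ε * η ((s - k) / ε) := by
    intro s
    have := mul_le_mul_of_nonneg_left (sub_one_le_mul_expNegInvGlue ((s - k) / ε)) hε.le
    rwa [mul_sub, mul_div_cancel₀ _ hε.ne', mul_one] at this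
  refine ⟨fun s => ε * η ((s - k) / ε) - ε * η ((-s - k) / ε), ?_, fun s => ?_, fun s => ?_,
    fun s hs => ?_, fun s hs => ?_, fun s => ?_⟩
  · exact (contDiff_const.mul (hsmooth.comp ((contDiff_id.sub contDiff_const).div_const ε))).sub
      (contDiff_const.mul (hsmooth.comp ((contDiff_id.neg.sub contDiff_const).div_const ε)))
  · rw [(hd s).deriv]
    exact add_nonneg (deriv_mul_expNegInvGlue_mem_Icc _).1 (deriv_mul_expNegInvGlue_mem_Icc _).1
  · rw [(hd s).deriv]
    rcases le_total s 0 with h | h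
    · rw [hη'0 ((s - k) / ε) (div_nonpos_of_nonpos_of_nonneg (by linarith) hε.le), zero_add]
      exact (deriv_mul_expNegInvGlue_mem_Icc _).2
    · rw [hη'0 ((-s - k) / ε) (div_nonpos_of_nonpos_of_nonneg (by linarith) hε.le), add_zero]
      exact (deriv_mul_expNegInvGlue_mem_Icc _).2
  · simp [hη0 _ (hneg s hs).1, hη0 _ (hneg s hs).2]
  · rw [(hd s).deriv, hη'0 _ (hneg s hs).1, hη'0 _ (hneg s hs).2, add_zero]
  · rcases le_total s 0 with h | h
    · rw [hη0 ((s - k) / ε) (div_nonpos_of_nonpos_of_nonneg (by linarith) hε.le),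
        abs_of_nonpos h, mul_zero, zero_sub, abs_neg]
      exact (hge (-s)).trans (le_abs_self _)
    · rw [hη0 ((-s - k) / ε) (div_nonpos_of_nonpos_of_nonneg (by linarith) hε.le),
        abs_of_nonneg h, mul_zero, sub_zero]
      exact (hge s).trans (le_abs_self _)

namespace IsSmoothTruncation

variable {H : ℝ → ℝ} {k ε : ℝ}

theorem norm_deriv_le_one (h : IsSmoothTruncation H k ε) (s : ℝ) : ‖deriv H s‖ ≤ 1 := by
  rw [Real.norm_of_nonneg (h.deriv_nonneg s)]
  exact h.deriv_le_one s

theorem differentiable (h : IsSmoothTruncation H k ε) : Differentiable ℝ H :=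
  h.contDiff.differentiable (by simp)

theorem continuous_deriv (h : IsSmoothTruncation H k ε) : Continuous (deriv H) :=
  h.contDiff.continuous_deriv (by exact_mod_cast le_top)

theorem norm_sub_le (h : IsSmoothTruncation H k ε) (s t : ℝ) : ‖H s - H t‖ ≤ ‖s - t‖ := by
  simpa using Convex.norm_image_sub_le_of_norm_deriv_le (s := Set.univ) (f := H)
    (fun x _ => h.differentiable x) (fun x _ => h.norm_deriv_le_one x) convex_univ
    (Set.mem_univ t) (Set.mem_univ s)

theorem map_zero (h : IsSmoothTruncation H k ε) (hk : 0 ≤ k) : H 0 = 0 :=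
  h.eq_zero 0 (by simpa using hk)

theorem norm_le (h : IsSmoothTruncation H k ε) (hk : 0 ≤ k) (s : ℝ) : ‖H s‖ ≤ ‖s‖ := by
  simpa [h.map_zero hk] using h.norm_sub_le s 0

end IsSmoothTruncation

theorem tendsto_eLpNorm_of_dominated {α E : Type*} [MeasurableSpace α] {μ : Measure α}
    [NormedAddCommGroup E] {p : ℝ≥0∞} (hp0 : p ≠ 0) (hpt : p ≠ ∞) {f : ℕ → α → E} {b : α → E}
    (hf : ∀ n, AEStronglyMeasurable (f n) μ) (hb : MemLp b p μ)
    (hfb : ∀ n, ∀ᵐ x ∂μ, ‖f n x‖ₑ ≤ ‖b x‖ₑ)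
    (hlim : ∀ᵐ x ∂μ, Tendsto (fun n => f n x) atTop (𝓝 0)) :
    Tendsto (fun n => eLpNorm (f n) p μ) atTop (𝓝 0) := by
  have hpr : 0 < p.toReal := ENNReal.toReal_pos hp0 hpt
  simp only [eLpNorm_eq_lintegral_rpow_enorm_toReal hp0 hpt]
  have h : Tendsto (fun n => ∫⁻ x, ‖f n x‖ₑ ^ p.toReal ∂μ) atTop (𝓝 (∫⁻ _, 0 ∂μ)) := by
    refine tendsto_lintegral_of_dominated_convergence' (fun x => ‖b x‖ₑ ^ p.toReal)
      (fun n => (hf n).enorm.pow_const _) (fun n => ?_) ?_ ?_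
    · filter_upwards [hfb n] with x hx
      gcongr
    · exact (lintegral_rpow_enorm_lt_top_of_eLpNorm_lt_top hp0 hpt hb.2).ne
    · filter_upwards [hlim] with x hx
      have h1 := (ENNReal.continuous_rpow_const (y := p.toReal)).tendsto 0 |>.comp
        (by simpa using hx.enorm : Tendsto (fun n => ‖f n x‖ₑ) atTop (𝓝 0))
      simpa [Function.comp_def, hpr] using h1
  rw [lintegral_zero] at h
  have h1 := (ENNReal.continuous_rpow_const (y := 1 / p.toReal)).tendsto 0 |>.comp h
  simpa [Function.comp_def, hpr] using h1

/-! ### Truncation in W₀^{1,p} and passage to the limit in Faber-Krahn. -/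

section Sobolev

variable {N d : ℕ} {X : Fin d → EuclideanSpace ℝ (Fin N) → EuclideanSpace ℝ (Fin N)}
  {Ω : Set (EuclideanSpace ℝ (Fin N))} {p : ℝ} {u : EuclideanSpace ℝ (Fin N) → ℝ}
  {g : EuclideanSpace ℝ (Fin N) → EuclideanSpace ℝ (Fin d)}

theorem xGrad_comp {H : ℝ → ℝ} {φ : EuclideanSpace ℝ (Fin N) → ℝ} (hH : Differentiable ℝ H)
    (hφ : Differentiable ℝ φ) (x : EuclideanSpace ℝ (Fin N)) :
    xGrad X (fun x => H (φ x)) x = deriv H (φ x) • xGrad X φ x := by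
  have h := ((hH (φ x)).hasDerivAt.comp_hasFDerivAt x (hφ x).hasFDerivAt).fderiv
  ext j
  simp only [xGrad, PiLp.smul_apply, smul_eq_mul]
  rw [show fderiv ℝ (fun x => H (φ x)) x = _ from h]
  simp

/-- Truncations of a suitable approximating sequence approximate the truncation. -/
theorem IsSobolevZero.exists_approx_truncation (hX : ∀ j, Continuous (X j)) (hp : 1 < p)
    (h : IsSobolevZero X Ω p u g) {H : ℝ → ℝ} {k ε : ℝ} (hH : IsSmoothTruncation H k ε) :
    ∃ φ : ℕ → EuclideanSpace ℝ (Fin N) → ℝ,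
      (∀ n, ContDiff ℝ (⊤ : ℕ∞) (φ n) ∧ HasCompactSupport (φ n) ∧ tsupport (φ n) ⊆ Ω) ∧
      TendstoInMeasure (volume.restrict Ω) φ atTop u ∧
      Tendsto (fun n => eLpNorm (fun x => H (φ n x) - H (u x)) (ENNReal.ofReal p)
        (volume.restrict Ω)) atTop (𝓝 0) ∧
      Tendsto (fun n => eLpNorm (fun x => xGrad X (fun y => H (φ n y)) x - deriv H (u x) • g x)
        (ENNReal.ofReal p) (volume.restrict Ω)) atTop (𝓝 0) := by
  obtain ⟨hu, hg, φ, hφ, hφu, hφg⟩ := h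
  have hp0 : ENNReal.ofReal p ≠ 0 := by simp; linarith
  have hp1 : 1 ≤ ENNReal.ofReal p := by simpa using hp.le
  have hφm : ∀ n, AEStronglyMeasurable (φ n) (volume.restrict Ω) :=
    fun n => (hφ n).1.continuous.aestronglyMeasurable
  have hφgm : ∀ n, AEStronglyMeasurable (xGrad X (φ n)) (volume.restrict Ω) := fun n =>
    (continuous_xGrad hX ((hφ n).1.of_le (by exact_mod_cast le_top))).aestronglyMeasurable
  have hmeas := tendstoInMeasure_of_tendsto_eLpNorm hp0 hφm hu.1 hφu
  -- Almost everywhere convergence gives H'(φₙ) → H'(u) pointwise; dominated convergence then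
  -- handles (H'(φₙ) - H'(u)) g in L^p.
  obtain ⟨ns, hns, hae⟩ := hmeas.exists_seq_tendsto_ae
  have hnst := hns.tendsto_atTop
  refine ⟨fun n => φ (ns n), fun n => hφ (ns n), hmeas.comp hnst, ?_, ?_⟩
  · refine tendsto_of_tendsto_of_tendsto_of_le_of_le tendsto_const_nhds (hφu.comp hnst)
      (fun _ => zero_le) fun n => ?_
    exact eLpNorm_mono fun x => hH.norm_sub_le _ _
  · have h1 : Tendsto (fun n => eLpNorm (fun x => (deriv H (φ (ns n) x) - deriv H (u x)) • g x)
        (ENNReal.ofReal p) (volume.restrict Ω)) atTop (𝓝 0) := by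
      refine tendsto_eLpNorm_of_dominated hp0 ENNReal.ofReal_ne_top (fun n => ?_) hg
        (fun n => ?_) ?_
      · exact ((hH.continuous_deriv.comp_aestronglyMeasurable (hφm _)).sub
          (hH.continuous_deriv.comp_aestronglyMeasurable hu.1)).smul hg.1
      · refine ae_of_all _ fun x => enorm_le_iff_norm_le.2 ?_
        rw [norm_smul]
        refine mul_le_of_le_one_left (norm_nonneg _) ?_
        rw [Real.norm_eq_abs, abs_le]
        constructor <;> linarith [hH.deriv_nonneg (φ (ns n) x), hH.deriv_nonneg (u x),
          hH.deriv_le_one (φ (ns n) x), hH.deriv_le_one (u x)]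
      · filter_upwards [hae] with x hx
        have h2 := (hH.continuous_deriv.tendsto (u x)).comp hx
        simpa using (h2.sub_const (deriv H (u x))).smul_const (g x)
    have h2 := (hφg.comp hnst).add h1
    rw [add_zero] at h2
    refine tendsto_of_tendsto_of_tendsto_of_le_of_le tendsto_const_nhds h2
      (fun _ => zero_le) fun n => ?_
    have e : (fun x => xGrad X (fun y => H (φ (ns n) y)) x - deriv H (u x) • g x) =
        (fun x => deriv H (φ (ns n) x) • (xGrad X (φ (ns n)) x - g x)) +
          fun x => (deriv H (φ (ns n) x) - deriv H (u x)) • g x := by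
      ext1 x
      rw [xGrad_comp hH.differentiable ((hφ _).1.differentiable (by simp))]
      simp only [Pi.add_apply, smul_sub, sub_smul]
      abel
    rw [e]
    refine (eLpNorm_add_le ?_ ?_ hp1).trans (add_le_add (eLpNorm_mono fun x => ?_) le_rfl)
    · exact (hH.continuous_deriv.comp_aestronglyMeasurable (hφm _)).smul ((hφgm _).sub hg.1)
    · exact ((hH.continuous_deriv.comp_aestronglyMeasurable (hφm _)).sub
          (hH.continuous_deriv.comp_aestronglyMeasurable hu.1)).smul hg.1
    · rw [norm_smul]
      exact mul_le_of_le_one_left (norm_nonneg _) (hH.norm_deriv_le_one _)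

theorem IsSobolevZero.truncation (hX : ∀ j, Continuous (X j)) (hp : 1 < p)
    (h : IsSobolevZero X Ω p u g) {H : ℝ → ℝ} {k ε : ℝ} (hk : 0 ≤ k)
    (hH : IsSmoothTruncation H k ε) :
    IsSobolevZero X Ω p (fun x => H (u x)) (fun x => deriv H (u x) • g x) := by
  obtain ⟨φ, hφ, -, h1, h2⟩ := h.exists_approx_truncation hX hp hH
  obtain ⟨hu, hg, -⟩ := h
  refine ⟨?_, ?_, fun n x => H (φ n x), fun n => ⟨?_, ?_, ?_⟩, h1, h2⟩
  · exact hu.mono (hH.contDiff.continuous.comp_aestronglyMeasurable hu.1)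
      (ae_of_all _ fun x => hH.norm_le hk _)
  · refine hg.mono ((hH.continuous_deriv.comp_aestronglyMeasurable hu.1).smul hg.1)
      (ae_of_all _ fun x => ?_)
    rw [norm_smul]
    exact mul_le_of_le_one_left (norm_nonneg _) (hH.norm_deriv_le_one _)
  · exact hH.contDiff.comp (hφ n).1
  · exact (hφ n).2.1.comp_left (hH.map_zero hk)
  · exact (closure_mono (Function.support_comp_subset (hH.map_zero hk) _)).trans (hφ n).2.2

/-- The Faber-Krahn inequality for truncations of Sobolev functions. -/
theorem IsSobolevZero.lintegral_truncation_le (hX : ∀ j, Continuous (X j)) (hp : 1 < p)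
    (hΩt : volume Ω ≠ ∞) {C q T : ℝ}
    (hFK : ∀ φ : EuclideanSpace ℝ (Fin N) → ℝ, ContDiff ℝ 1 φ → HasCompactSupport φ →
      tsupport φ ⊆ Ω → ∀ t, 0 < t → t ≤ T →
      volume (Function.support φ) ≤ ENNReal.ofReal t →
      ∫⁻ x, ‖φ x‖ₑ ≤ ENNReal.ofReal (C * t ^ q) * ∫⁻ x, ‖xGrad X φ x‖ₑ)
    (h : IsSobolevZero X Ω p u g) {H : ℝ → ℝ} {k l ε : ℝ} (hk : 0 ≤ k) (hkl : k < l)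
    (hH : IsSmoothTruncation H l ε) {t : ℝ} (ht : 0 < t) (htT : t ≤ T)
    (hvol : volume.restrict Ω {x | k < |u x|} < ENNReal.ofReal t) :
    ∫⁻ x in Ω, ‖H (u x)‖ₑ ≤
      ENNReal.ofReal (C * t ^ q) * ∫⁻ x in Ω, ‖deriv H (u x) • g x‖ₑ := by
  have hΩf : IsFiniteMeasure (volume.restrict Ω) := ⟨by simpa using hΩt.lt_top⟩
  have hS := h.truncation hX hp (hk.trans hkl.le) hH
  obtain ⟨φ, hφ, hmeas, h1, h2⟩ := h.exists_approx_truncation hX hp hH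
  have hp1 : 1 ≤ ENNReal.ofReal p := by simpa using hp.le
  have hψ : ∀ n, ContDiff ℝ 1 (fun x => H (φ n x)) := fun n =>
    (hH.contDiff.comp (hφ n).1).of_le (by exact_mod_cast le_top)
  have hts : ∀ n, tsupport (fun x => H (φ n x)) ⊆ Ω := fun n =>
    (closure_mono (Function.support_comp_subset (hH.map_zero (hk.trans hkl.le)) _)).trans
      (hφ n).2.2
  -- Where H(φₙ) ≠ 0 one has |φₙ| > l, so either |u| > k or |φₙ - u| ≥ l - k. The second set has
  -- measure tending to 0, and the strict inequality in `hvol` leaves room for it.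
  have hsupp : ∀ᶠ n in atTop, volume (Function.support fun x => H (φ n x)) ≤
      ENNReal.ofReal t := by
    have h3 := (hmeas (ENNReal.ofReal (l - k)) (by simpa using hkl)).const_add
      (volume.restrict Ω {x | k < |u x|})
    rw [add_zero] at h3
    filter_upwards [h3.eventually_lt_const hvol] with n hn
    refine le_trans ?_ hn.le
    have h4 : Function.support (fun x => H (φ n x)) ⊆ Ω :=
      (subset_tsupport _).trans (hts n)
    rw [← Measure.restrict_eq_self volume h4]
    refine (measure_mono fun x hx => ?_).trans (measure_union_le _ _)
    by_cases hxu : k < |u x|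
    · exact Or.inl hxu
    · refine Or.inr ?_
      have h5 : l < |φ n x| := by
        by_contra h6
        exact hx (hH.eq_zero _ (not_lt.1 h6))
      rw [Set.mem_ofPred_eq, edist_dist]
      refine ENNReal.ofReal_le_ofReal ?_
      rw [Real.dist_eq]
      linarith [abs_sub_abs_le_abs_sub (φ n x) (u x), not_lt.1 hxu]
  have hΩ1 := measure_ne_top (volume.restrict Ω) Set.univ
  have hL1 : ∀ {E : Type} [NormedAddCommGroup E] (f : ℕ → EuclideanSpace ℝ (Fin N) → E),
      (∀ n, AEStronglyMeasurable (f n) (volume.restrict Ω)) →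
      Tendsto (fun n => eLpNorm (f n) (ENNReal.ofReal p) (volume.restrict Ω)) atTop (𝓝 0) →
      Tendsto (fun n => eLpNorm (f n) 1 (volume.restrict Ω)) atTop (𝓝 0) := by
    intro E _ f hf hlim
    have h5 := ENNReal.Tendsto.mul_const (b := volume.restrict Ω Set.univ ^
      (1 / (1 : ℝ≥0∞).toReal - 1 / (ENNReal.ofReal p).toReal)) hlim
      (Or.inr (ENNReal.rpow_ne_top_of_nonneg (by
        rw [ENNReal.toReal_ofReal (by linarith), ENNReal.toReal_one, sub_nonneg]
        exact one_div_le_one_div_of_le one_pos hp.le) hΩ1))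
    rw [zero_mul] at h5
    exact tendsto_of_tendsto_of_tendsto_of_le_of_le tendsto_const_nhds h5 (fun _ => zero_le)
      fun n => eLpNorm_le_eLpNorm_mul_rpow_measure_univ hp1 (hf n)
  have hm1 : ∀ n, AEStronglyMeasurable (fun x => H (φ n x)) (volume.restrict Ω) :=
    fun n => (hψ n).continuous.aestronglyMeasurable
  have hm2 : ∀ n, AEStronglyMeasurable (xGrad X fun x => H (φ n x)) (volume.restrict Ω) :=
    fun n => (continuous_xGrad hX (hψ n)).aestronglyMeasurable
  have hlim1 := hL1 _ (fun n => (hm1 n).sub hS.1.1) h1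
  have hlim2 := hL1 _ (fun n => (hm2 n).sub hS.2.1.1) h2
  have hc : ENNReal.ofReal (C * t ^ q) ≠ ∞ := ENNReal.ofReal_ne_top
  have hlim : Tendsto (fun n => ENNReal.ofReal (C * t ^ q) *
      (eLpNorm (fun x => xGrad X (fun y => H (φ n y)) x - deriv H (u x) • g x) 1
        (volume.restrict Ω) + eLpNorm (fun x => deriv H (u x) • g x) 1 (volume.restrict Ω)) +
      eLpNorm (fun x => H (φ n x) - H (u x)) 1 (volume.restrict Ω)) atTop
      (𝓝 (ENNReal.ofReal (C * t ^ q) *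
        (0 + eLpNorm (fun x => deriv H (u x) • g x) 1 (volume.restrict Ω)) + 0)) :=
    (ENNReal.Tendsto.const_mul (hlim2.add tendsto_const_nhds) (Or.inr hc)).add hlim1
  rw [zero_add, add_zero] at hlim
  simp only [← eLpNorm_one_eq_lintegral_enorm]
  refine ge_of_tendsto hlim (hsupp.mono fun n hn => ?_)
  have h6 : eLpNorm (fun x => H (u x)) 1 (volume.restrict Ω) ≤
      eLpNorm (fun x => H (φ n x)) 1 (volume.restrict Ω) +
        eLpNorm (fun x => H (φ n x) - H (u x)) 1 (volume.restrict Ω) := by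
    have := eLpNorm_sub_le (hm1 n) ((hm1 n).sub hS.1.1) le_rfl
    rwa [sub_sub_cancel] at this
  have h7 : eLpNorm (xGrad X fun x => H (φ n x)) 1 (volume.restrict Ω) ≤
      eLpNorm (fun x => xGrad X (fun y => H (φ n y)) x - deriv H (u x) • g x) 1
        (volume.restrict Ω) + eLpNorm (fun x => deriv H (u x) • g x) 1 (volume.restrict Ω) := by
    have := eLpNorm_add_le ((hm2 n).sub hS.2.1.1) hS.2.1.1 le_rfl
    rwa [sub_add_cancel] at this
  refine h6.trans (add_le_add ?_ le_rfl)
  refine le_trans ?_ (mul_le_mul_right h7 _)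
  simp only [eLpNorm_one_eq_lintegral_enorm]
  refine (setLIntegral_le_lintegral _ _).trans ((hFK _ (hψ n)
    ((hφ n).2.1.comp_left (hH.map_zero (hk.trans hkl.le))) (hts n) t ht htT hn).trans_eq ?_)
  congr 1
  rw [setLIntegral_eq_of_support_subset]
  intro x hx
  exact hts n (support_xGrad_subset _ (by simpa using hx))

end Sobolev

/-! ### The energy estimate. -/

theorem aestronglyMeasurable_simpleFunc_comp {α β γ : Type*} [MeasurableSpace α]
    {μ : Measure α} [NormedAddCommGroup γ] (f : SimpleFunc α β) {F : β → α → γ}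
    (hF : ∀ q, AEStronglyMeasurable (F q) μ) : AEStronglyMeasurable (fun x => F (f x) x) μ := by
  classical
  have e : (fun x => F (f x) x) = fun x => ∑ q ∈ f.range, (f ⁻¹' {q}).indicator (F q) x := by
    ext x
    rw [Finset.sum_eq_single (f x)]
    · simp
    · intro q _ hq
      exact Set.indicator_of_notMem (fun h => hq h.symm) _
    · intro h
      exact absurd (f.mem_range_self x) h
  rw [e]
  exact Finset.aestronglyMeasurable_fun_sum _ fun q _ => (hF q).indicator (f.measurableSet_fiber q)

/-- Approximate v by simple functions, for which the composite is a finite sum of measurable pieces;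
continuity in q passes to the limit. -/
theorem aestronglyMeasurable_caratheodory {α β γ : Type*} [MeasurableSpace α] {μ : Measure α}
    [TopologicalSpace β] [NormedAddCommGroup γ] {F : β → α → γ}
    (hF : ∀ q, AEStronglyMeasurable (F q) μ) (hc : ∀ᵐ x ∂μ, Continuous fun q => F q x)
    {v : α → β} (hv : AEStronglyMeasurable v μ) :
    AEStronglyMeasurable (fun x => F (v x) x) μ := by
  refine aestronglyMeasurable_of_tendsto_ae atTop
    (f := fun n x => F (hv.stronglyMeasurable_mk.approx n x) x)
    (fun n => aestronglyMeasurable_simpleFunc_comp _ hF) ?_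
  filter_upwards [hc, hv.ae_eq_mk] with x hx hvx
  rw [hvx]
  exact (hx.tendsto _).comp (hv.stronglyMeasurable_mk.tendsto_approx x)

section Energy

variable {N d : ℕ} {X : Fin d → EuclideanSpace ℝ (Fin N) → EuclideanSpace ℝ (Fin N)}
  {Ω : Set (EuclideanSpace ℝ (Fin N))} {p α : ℝ}
  {a : EuclideanSpace ℝ (Fin N) → ℝ → EuclideanSpace ℝ (Fin d) → EuclideanSpace ℝ (Fin d)}
  {F : EuclideanSpace ℝ (Fin N) → EuclideanSpace ℝ (Fin d)}
  {u : EuclideanSpace ℝ (Fin N) → ℝ}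
  {g : EuclideanSpace ℝ (Fin N) → EuclideanSpace ℝ (Fin d)}

theorem IsLerayLions.memLp_comp (ha : IsLerayLions Ω p α a) (hp : 1 < p)
    (hu : MemLp u (ENNReal.ofReal p) (volume.restrict Ω))
    (hg : MemLp g (ENNReal.ofReal p) (volume.restrict Ω)) :
    MemLp (fun x => a x (u x) (g x)) (ENNReal.ofReal (p / (p - 1))) (volume.restrict Ω) := by
  obtain ⟨β, h, hβ, hh, hb⟩ := ha.growth
  have hm : AEStronglyMeasurable (fun x => a x (u x) (g x)) (volume.restrict Ω) :=
    aestronglyMeasurable_caratheodory (F := fun q x => a x q.1 q.2)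
      (fun q => ha.measurable q.1 q.2) ha.continuous (hu.1.prodMk hg.1)
  have hpow : ∀ {E : Type} [NormedAddCommGroup E] {f : EuclideanSpace ℝ (Fin N) → E},
      MemLp f (ENNReal.ofReal p) (volume.restrict Ω) →
      MemLp (fun x => ‖f x‖ ^ (p - 1)) (ENNReal.ofReal (p / (p - 1))) (volume.restrict Ω) := by
    intro E _ f hf
    have := hf.norm_rpow_div (ENNReal.ofReal (p - 1))
    rwa [ENNReal.toReal_ofReal (by linarith), ← ENNReal.ofReal_div_of_pos (by linarith)] at this
  refine (((hh.add (hpow hu)).add (hpow hg)).const_mul β).of_le hm ?_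
  filter_upwards [hb] with x hx
  exact (hx _ _).trans (le_abs_self _)

theorem MeasureTheory.MemLp.integrable_inner_of_holderConjugate {α E : Type*} [MeasurableSpace α]
    {μ : Measure α} [NormedAddCommGroup E] [InnerProductSpace ℝ E] {p q : ℝ}
    (hpq : p.HolderConjugate q) {f g : α → E}
    (hf : MemLp f (ENNReal.ofReal q) μ) (hg : MemLp g (ENNReal.ofReal p) μ) :
    Integrable (fun x => inner ℝ (f x) (g x)) μ := by
  have := hpq.symm.ennrealOfReal
  refine (hf.norm.integrable_mul hg.norm).mono (hf.1.inner hg.1) (ae_of_all _ fun x => ?_)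
  simpa using abs_real_inner_le_norm (f x) (g x)

/-- Testing the equation with a truncation of the solution. -/
theorem lintegral_deriv_truncation_mul_rpow_le (hX : ∀ j, Continuous (X j)) (hp : 1 < p)
    (hα : 0 < α) (ha : IsLerayLions Ω p α a)
    (hF : MemLp F (ENNReal.ofReal (p / (p - 1))) (volume.restrict Ω))
    (hug : IsSobolevZero X Ω p u g)
    (hweak : ∀ v w, IsSobolevZero X Ω p v w →
      ∫ x in Ω, inner ℝ (a x (u x) (g x)) (w x) = ∫ x in Ω, inner ℝ (F x) (w x))
    {H : ℝ → ℝ} {l ε : ℝ} (hl : 0 ≤ l) (hH : IsSmoothTruncation H l ε) :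
    ENNReal.ofReal α * ∫⁻ x in Ω, ENNReal.ofReal (deriv H (u x)) * ‖g x‖ₑ ^ p ≤
      ∫⁻ x in Ω, ‖F x‖ₑ * (ENNReal.ofReal (deriv H (u x)) * ‖g x‖ₑ) := by
  have hpq : p.HolderConjugate (p / (p - 1)) := Real.HolderConjugate.conjExponent hp
  have hw := hug.truncation hX hp hl hH
  have hA := MemLp.integrable_inner_of_holderConjugate hpq (ha.memLp_comp hp hug.1 hug.2.1) hw.2.1
  have hI := hweak _ _ hw
  have hDm : AEStronglyMeasurable (fun x => deriv H (u x)) (volume.restrict Ω) :=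
    hH.continuous_deriv.comp_aestronglyMeasurable hug.1.1
  have hgp : Integrable (fun x => ‖g x‖ ^ p) (volume.restrict Ω) := by
    have := hug.2.1.integrable_norm_rpow (by simp; linarith) ENNReal.ofReal_ne_top
    rwa [ENNReal.toReal_ofReal (by linarith)] at this
  have hE : Integrable (fun x => α * (deriv H (u x) * ‖g x‖ ^ p)) (volume.restrict Ω) := by
    refine (hgp.mono (hDm.mul hgp.1) (ae_of_all _ fun x => ?_)).const_mul α
    rw [Pi.mul_apply, norm_mul]
    exact mul_le_of_le_one_left (norm_nonneg _) (hH.norm_deriv_le_one _)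
  have hle : ∫ x in Ω, α * (deriv H (u x) * ‖g x‖ ^ p) ≤
      ∫ x in Ω, inner ℝ (F x) (deriv H (u x) • g x) := by
    rw [← hI]
    refine integral_mono_ae hE hA ?_
    filter_upwards [ha.elliptic] with x hx
    rw [real_inner_smul_right]
    nlinarith [hx (u x) (g x), hH.deriv_nonneg (u x)]
  have h1 := ENNReal.ofReal_le_ofReal hle
  rw [ofReal_integral_eq_lintegral_ofReal hE
    (ae_of_all _ fun x => mul_nonneg hα.le (mul_nonneg (hH.deriv_nonneg _) (by positivity)))] at h1
  calc ENNReal.ofReal α * ∫⁻ x in Ω, ENNReal.ofReal (deriv H (u x)) * ‖g x‖ₑ ^ p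
      = ∫⁻ x in Ω, ENNReal.ofReal (α * (deriv H (u x) * ‖g x‖ ^ p)) := by
        rw [← lintegral_const_mul' _ _ ENNReal.ofReal_ne_top]
        refine lintegral_congr fun x => ?_
        rw [ENNReal.ofReal_mul hα.le, ENNReal.ofReal_mul (hH.deriv_nonneg _),
          ← ENNReal.ofReal_rpow_of_nonneg (norm_nonneg _) (by linarith), ofReal_norm]
    _ ≤ _ := h1
    _ ≤ ENNReal.ofReal (∫ x in Ω, ‖inner ℝ (F x) (deriv H (u x) • g x)‖) :=
        ENNReal.ofReal_le_ofReal ((Real.le_norm_self _).trans (norm_integral_le_integral_norm _))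
    _ = ∫⁻ x in Ω, ‖inner ℝ (F x) (deriv H (u x) • g x)‖ₑ :=
        ofReal_integral_norm_eq_lintegral_enorm
          (MemLp.integrable_inner_of_holderConjugate hpq hF hw.2.1)
    _ ≤ _ := by
        refine lintegral_mono fun x => ?_
        rw [← ofReal_norm, ← ofReal_norm, ← ofReal_norm,
          ← ENNReal.ofReal_mul (hH.deriv_nonneg _), ← ENNReal.ofReal_mul (norm_nonneg _)]
        refine ENNReal.ofReal_le_ofReal ((norm_inner_le_norm _ _).trans_eq ?_)
        rw [norm_smul, Real.norm_of_nonneg (hH.deriv_nonneg _)]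

/-- Let D = H'(u), W = D^(1/p)|g| and E = ∫W^p. Since D ≤ 1, D|g| ≤ W, and Hölder turns the energy
bound into αE ≤ Φ E^(1/p), with Φ the norm of F on S. Dividing bounds E; a second Hölder inequality
against the indicator of S returns to L¹. -/
theorem lintegral_truncation_grad_le_of_energy (hp : 1 < p) (hα : 0 < α)
    (hFm : AEStronglyMeasurable F (volume.restrict Ω))
    (hu : AEStronglyMeasurable u (volume.restrict Ω))
    (hg : MemLp g (ENNReal.ofReal p) (volume.restrict Ω))
    {H : ℝ → ℝ} {l ε : ℝ} (hH : IsSmoothTruncation H l ε)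
    (hen : ENNReal.ofReal α * ∫⁻ x in Ω, ENNReal.ofReal (deriv H (u x)) * ‖g x‖ₑ ^ p ≤
      ∫⁻ x in Ω, ‖F x‖ₑ * (ENNReal.ofReal (deriv H (u x)) * ‖g x‖ₑ))
    {S : Set (EuclideanSpace ℝ (Fin N))} (hS : MeasurableSet S) (hSu : ∀ x ∉ S, |u x| ≤ l) :
    ∫⁻ x in Ω, ‖deriv H (u x) • g x‖ₑ ≤
      volume.restrict Ω S ^ (1 / (p / (p - 1))) * ((ENNReal.ofReal α)⁻¹ *
        eLpNorm F (ENNReal.ofReal (p / (p - 1))) ((volume.restrict Ω).restrict S)) ^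
          (1 / (p - 1)) := by
  set μ := volume.restrict Ω
  set q := p / (p - 1) with hq
  have hpq : p.HolderConjugate q := Real.HolderConjugate.conjExponent hp
  have hp0 : 0 < p := by linarith
  have hq0 : 0 < q := hpq.symm.pos
  have hα0 : ENNReal.ofReal α ≠ 0 := by simpa using hα
  set D : EuclideanSpace ℝ (Fin N) → ℝ≥0∞ := fun x => ENNReal.ofReal (deriv H (u x)) with hDdef
  set W : EuclideanSpace ℝ (Fin N) → ℝ≥0∞ := fun x => D x ^ (1 / p) * ‖g x‖ₑ with hWdef
  have hDm : AEMeasurable D μ :=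
    (hH.continuous_deriv.comp_aestronglyMeasurable hu).aemeasurable.ennreal_ofReal
  have hWm : AEMeasurable W μ := (hDm.pow_const _).mul hg.1.enorm
  have hD1 : ∀ x, D x ≤ 1 := fun x => by simpa [hDdef] using hH.deriv_le_one (u x)
  have hDW : ∀ x, D x * ‖g x‖ₑ ≤ W x := by
    intro x
    refine mul_le_mul_left ?_ _
    simpa using ENNReal.rpow_le_rpow_of_exponent_ge (hD1 x)
      (show 1 / p ≤ 1 by rw [div_le_one hp0]; exact hp.le)
  have hD0 : ∀ x ∉ S, D x = 0 := fun x hx => by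
    simp [hDdef, hH.deriv_eq_zero _ (hSu x hx)]
  have hWp : ∀ x, W x ^ p = D x * ‖g x‖ₑ ^ p := by
    intro x
    rw [hWdef, ENNReal.mul_rpow_of_nonneg _ _ hp0.le, ← ENNReal.rpow_mul,
      one_div_mul_cancel hp0.ne', ENNReal.rpow_one]
  set E := ∫⁻ x, W x ^ p ∂μ with hE
  have hEt : E ≠ ∞ := by
    have h1 := lintegral_rpow_enorm_lt_top_of_eLpNorm_lt_top (by simpa using hp0)
      ENNReal.ofReal_ne_top hg.2
    rw [ENNReal.toReal_ofReal hp0.le] at h1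
    refine (lt_of_le_of_lt (lintegral_mono fun x => ?_) h1).ne
    rw [hWp]
    exact mul_le_of_le_one_left' (hD1 x)
  set Φ := eLpNorm F (ENNReal.ofReal q) (μ.restrict S)
  have hΦ : Φ = (∫⁻ x, S.indicator (fun x => ‖F x‖ₑ) x ^ q ∂μ) ^ (1 / q) := by
    rw [show Φ = _ from eLpNorm_eq_lintegral_rpow_enorm_toReal (by simpa using hq0)
      ENNReal.ofReal_ne_top, ENNReal.toReal_ofReal hq0.le, ← lintegral_indicator hS]
    congr 2
    ext x
    by_cases hx : x ∈ S <;> simp [hx, hq0]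
  have hholder : ∀ f : EuclideanSpace ℝ (Fin N) → ℝ≥0∞, AEMeasurable f μ →
      ∫⁻ x, f x * (D x * ‖g x‖ₑ) ∂μ ≤
        (∫⁻ x, S.indicator f x ^ q ∂μ) ^ (1 / q) * E ^ (1 / p) := by
    intro f hf
    refine le_trans (lintegral_mono fun x => ?_)
      (ENNReal.lintegral_mul_le_Lp_mul_Lq μ hpq.symm (hf.indicator hS) hWm)
    by_cases hx : x ∈ S
    · simpa [hx] using mul_le_mul_right (hDW x) (f x)
    · simp [hD0 x hx]
  have h1 : ENNReal.ofReal α * E ≤ Φ * E ^ (1 / p) := by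
    have := hen.trans (hholder (fun x => ‖F x‖ₑ) hFm.enorm)
    rw [← hΦ] at this
    simpa only [hE, hWp] using this
  -- Dividing by E^(1/p) requires E to be finite and nonzero; finiteness comes from g ∈ L^p.
  have h2 : E ^ (1 / q) ≤ (ENNReal.ofReal α)⁻¹ * Φ := by
    rcases eq_or_ne E 0 with hE0 | hE0
    · rw [hE0, ENNReal.zero_rpow_of_pos (by positivity)]
      exact zero_le
    · have h3 : E = E ^ (1 / q) * E ^ (1 / p) := by
        rw [← ENNReal.rpow_add _ _ hE0 hEt, one_div, one_div, hpq.symm.inv_add_inv_eq_one,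
          ENNReal.rpow_one]
      have h4 : E ^ (1 / p) ≠ 0 := by simp [hE0, hEt]
      have h5 : E ^ (1 / p) ≠ ∞ := ENNReal.rpow_ne_top_of_nonneg (by positivity) hEt
      rw [← ENNReal.mul_le_iff_le_inv hα0 ENNReal.ofReal_ne_top]
      rw [h3, ← mul_assoc, ← h3] at h1
      exact (ENNReal.mul_le_mul_iff_left h4 h5).1 h1
  have h3 : E ^ (1 / p) ≤ ((ENNReal.ofReal α)⁻¹ * Φ) ^ (1 / (p - 1)) := by
    have h4 := ENNReal.rpow_le_rpow h2 (show 0 ≤ 1 / (p - 1) by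
      rw [one_div_nonneg]; linarith)
    rwa [← ENNReal.rpow_mul, show 1 / q * (1 / (p - 1)) = 1 / p by
      rw [hq]
      have : p - 1 ≠ 0 := by linarith
      field_simp] at h4
  have h4 := hholder (fun _ => 1) aemeasurable_const
  have h5 : ∫⁻ x, S.indicator (fun _ => (1 : ℝ≥0∞)) x ^ q ∂μ = μ S := by
    rw [← lintegral_indicator_one hS]
    refine lintegral_congr fun x => ?_
    by_cases hx : x ∈ S <;> simp [hx, hq0]
  rw [h5] at h4
  calc ∫⁻ x, ‖deriv H (u x) • g x‖ₑ ∂μ = ∫⁻ x, 1 * (D x * ‖g x‖ₑ) ∂μ := by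
        refine lintegral_congr fun x => ?_
        rw [enorm_smul, one_mul, Real.enorm_of_nonneg (hH.deriv_nonneg _)]
    _ ≤ μ S ^ (1 / q) * E ^ (1 / p) := h4
    _ ≤ _ := mul_le_mul_right h3 _

/-- The preceding estimate with the data measured in `L^m`. -/
theorem lintegral_truncation_grad_le (hX : ∀ j, Continuous (X j)) (hp : 1 < p)
    (hΩt : volume Ω ≠ ∞) (hα : 0 < α) (ha : IsLerayLions Ω p α a) {m : ℝ≥0∞}
    (hm : ENNReal.ofReal (p / (p - 1)) ≤ m) (hF : MemLp F m (volume.restrict Ω))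
    (hug : IsSobolevZero X Ω p u g)
    (hweak : ∀ v w, IsSobolevZero X Ω p v w →
      ∫ x in Ω, inner ℝ (a x (u x) (g x)) (w x) = ∫ x in Ω, inner ℝ (F x) (w x))
    {H : ℝ → ℝ} {k l ε : ℝ} (hk : 0 ≤ k) (hkl : k < l) (hH : IsSmoothTruncation H l ε) :
    ∫⁻ x in Ω, ‖deriv H (u x) • g x‖ₑ ≤
      ((ENNReal.ofReal α)⁻¹ * eLpNorm F m (volume.restrict Ω)) ^ (1 / (p - 1)) *
        volume.restrict Ω {x | k < |u x|} ^ (1 - 1 / (m.toReal * (p - 1))) := by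
  have hΩf : IsFiniteMeasure (volume.restrict Ω) := ⟨by simpa using hΩt.lt_top⟩
  set μ := volume.restrict Ω
  -- The level set need not be measurable, as u is only almost everywhere equal to a measurable
  -- function; its hull has the same measure.
  set S := toMeasurable μ {x | k < |u x|}
  have hSu : ∀ x ∉ S, |u x| ≤ l := fun x hx => by
    by_contra h
    exact hx (subset_toMeasurable μ _ (hkl.trans (not_le.1 h)))
  have h1 := lintegral_truncation_grad_le_of_energy hp hα hF.1 hug.1.1 hug.2.1 hH
    (lintegral_deriv_truncation_mul_rpow_le hX hp hα ha (hF.mono_exponent hm) hug hweak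
      (hk.trans hkl.le) hH) (measurableSet_toMeasurable _ _) hSu
  have hp1 : 0 < p - 1 := by linarith
  have hq0 : 0 < p / (p - 1) := by positivity
  have h2 : eLpNorm F (ENNReal.ofReal (p / (p - 1))) (μ.restrict S) ≤
      eLpNorm F m μ * μ S ^ (1 / (p / (p - 1)) - 1 / m.toReal) := by
    have h3 := eLpNorm_le_eLpNorm_mul_rpow_measure_univ hm (hF.1.mono_measure
      (Measure.restrict_le_self (s := S)))
    rw [ENNReal.toReal_ofReal hq0.le, Measure.restrict_apply_univ] at h3
    exact h3.trans (mul_le_mul_left (eLpNorm_mono_measure _ Measure.restrict_le_self) _)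
  have hexp : 0 ≤ 1 / (p / (p - 1)) - 1 / m.toReal := by
    rcases eq_or_ne m ∞ with rfl | hmt
    · simp; positivity
    · rw [sub_nonneg]
      exact one_div_le_one_div_of_le hq0 ((ENNReal.ofReal_le_iff_le_toReal hmt).1 hm)
  rw [← measure_toMeasurable {x | k < |u x|}]
  refine h1.trans ?_
  calc μ S ^ (1 / (p / (p - 1))) * ((ENNReal.ofReal α)⁻¹ *
        eLpNorm F (ENNReal.ofReal (p / (p - 1))) (μ.restrict S)) ^ (1 / (p - 1))
      ≤ μ S ^ (1 / (p / (p - 1))) * ((ENNReal.ofReal α)⁻¹ *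
        (eLpNorm F m μ * μ S ^ (1 / (p / (p - 1)) - 1 / m.toReal))) ^ (1 / (p - 1)) := by
        gcongr
    _ = _ := by
        rw [← mul_assoc, ENNReal.mul_rpow_of_nonneg _ _ (by positivity), ← ENNReal.rpow_mul,
          mul_left_comm, ← ENNReal.rpow_add_of_nonneg _ _ (by positivity) (by positivity)]
        congr 2
        -- The case m = ∞: there `m.toReal = 0`, and 1/0 = 0 is the correct value of 1/m. In general
        -- the exponents add up to 1/p' + (1/p' - 1/m)/(p-1) = 1 - 1/(m(p-1)).
        rcases eq_or_ne m.toReal 0 with h0 | h0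
        · rw [h0]
          field_simp
          ring
        · field_simp
          ring

end Energy

/-! ### Decay of the level sets. -/

/-- Stampacchia's lemma. -/
theorem stampacchia {f : ℝ → ℝ} {M A σ D : ℝ} (hf : Antitone f) (hf0 : ∀ k, 0 ≤ f k)
    (hfA : f 0 ≤ A) (hM : 0 ≤ M) (hσ : 0 < σ) (hD : 0 < D)
    (hrec : ∀ k h, 0 ≤ k → k < h → (h - k) * f h ≤ M * f k ^ (1 + σ))
    (hMD : 2 * M * A ^ σ * 2 ^ (1 / σ) ≤ D) : f D = 0 := by
  set b : ℝ := (2 ^ (1 / σ))⁻¹ with hb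
  have hc1 : (1 : ℝ) < 2 ^ (1 / σ) := Real.one_lt_rpow one_lt_two (by positivity)
  have hb0 : 0 < b := by positivity
  have hb1 : b < 1 := inv_lt_one_of_one_lt₀ hc1
  have hA : 0 ≤ A := (hf0 0).trans hfA
  have hbσ : b ^ σ = 2⁻¹ := by
    rw [hb, Real.inv_rpow (by positivity), ← Real.rpow_mul zero_le_two,
      one_div_mul_cancel hσ.ne', Real.rpow_one]
  have hMb : 2 * M * A ^ σ ≤ D * b := by
    rw [hb, ← div_eq_mul_inv, le_div_iff₀ (by positivity)]
    exact hMD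
  -- Geometric decay along the levels D(1 - 2⁻ⁿ). Since b^σ = 1/2, the factor (bⁿ)^σ = 2⁻ⁿ cancels
  -- the shrinking gaps D 2^(-n-1), and the induction closes exactly when 2MA^σ ≤ Db.
  have key : ∀ n : ℕ, f (D * (1 - 2⁻¹ ^ n)) ≤ A * b ^ n := by
    intro n
    induction n with
    | zero => simpa using hfA
    | succ n ih =>
      have h2 : (2⁻¹ : ℝ) ^ n ≤ 1 := pow_le_one₀ (by norm_num) (by norm_num)
      have h2' : (0 : ℝ) < 2⁻¹ ^ n := by positivity
      have h1 := hrec (D * (1 - 2⁻¹ ^ n)) (D * (1 - 2⁻¹ ^ (n + 1)))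
        (mul_nonneg hD.le (by linarith))
        (mul_lt_mul_of_pos_left (by rw [pow_succ]; linarith) hD)
      have h3 : f (D * (1 - 2⁻¹ ^ n)) ^ (1 + σ) ≤ A * A ^ σ * (b ^ n * 2⁻¹ ^ n) := by
        calc f (D * (1 - 2⁻¹ ^ n)) ^ (1 + σ) ≤ (A * b ^ n) ^ (1 + σ) :=
              Real.rpow_le_rpow (hf0 _) ih (by positivity)
          _ = A ^ (1 + σ) * (b ^ n) ^ (1 + σ) := Real.mul_rpow hA (by positivity)
          _ = _ := by
            rw [Real.rpow_add_of_nonneg hA zero_le_one hσ.le, Real.rpow_one,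
              Real.rpow_add_of_nonneg (by positivity) zero_le_one hσ.le, Real.rpow_one,
              ← Real.rpow_pow_comm hb0.le, hbσ]
      have h4 : D * (2⁻¹ ^ n * 2⁻¹) * f (D * (1 - 2⁻¹ ^ (n + 1))) ≤
          D * (2⁻¹ ^ n * 2⁻¹) * (A * b ^ (n + 1)) := by
        calc D * (2⁻¹ ^ n * 2⁻¹) * f (D * (1 - 2⁻¹ ^ (n + 1)))
            = (D * (1 - 2⁻¹ ^ (n + 1)) - D * (1 - 2⁻¹ ^ n)) *
                f (D * (1 - 2⁻¹ ^ (n + 1))) := by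
              congr 1
              rw [pow_succ]
              ring
          _ ≤ M * (A * A ^ σ * (b ^ n * 2⁻¹ ^ n)) :=
              h1.trans (mul_le_mul_of_nonneg_left h3 hM)
          _ = 2 * M * A ^ σ * (2⁻¹ ^ n * 2⁻¹ * (A * b ^ n)) := by ring
          _ ≤ D * b * (2⁻¹ ^ n * 2⁻¹ * (A * b ^ n)) :=
              mul_le_mul_of_nonneg_right hMb (by positivity)
          _ = _ := by ring
      exact le_of_mul_le_mul_left h4 (by positivity)
  have hlim : Tendsto (fun n : ℕ => A * b ^ n) atTop (𝓝 0) := by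
    simpa using (tendsto_pow_atTop_nhds_zero_of_lt_one hb0.le hb1).const_mul A
  refine le_antisymm (ge_of_tendsto' hlim fun n => (hf ?_).trans (key n)) (hf0 D)
  have : (0 : ℝ) < 2⁻¹ ^ n := by positivity
  nlinarith

section LevelSets

variable {N d : ℕ} {X : Fin d → EuclideanSpace ℝ (Fin N) → EuclideanSpace ℝ (Fin N)}
  {Ω : Set (EuclideanSpace ℝ (Fin N))} {p α : ℝ}
  {a : EuclideanSpace ℝ (Fin N) → ℝ → EuclideanSpace ℝ (Fin d) → EuclideanSpace ℝ (Fin d)}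
  {F : EuclideanSpace ℝ (Fin N) → EuclideanSpace ℝ (Fin d)}
  {u : EuclideanSpace ℝ (Fin N) → ℝ}
  {g : EuclideanSpace ℝ (Fin N) → EuclideanSpace ℝ (Fin d)}

/-- The decay of the level sets of a weak solution. -/
theorem sub_mul_measureReal_level_le (hX : ∀ j, Continuous (X j)) (hp : 1 < p)
    (hΩt : volume Ω ≠ ∞) (hα : 0 < α) (ha : IsLerayLions Ω p α a) {m : ℝ≥0∞}
    (hm : ENNReal.ofReal (p / (p - 1)) ≤ m) (hF : MemLp F m (volume.restrict Ω))
    (hug : IsSobolevZero X Ω p u g)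
    (hweak : ∀ v w, IsSobolevZero X Ω p v w →
      ∫ x in Ω, inner ℝ (a x (u x) (g x)) (w x) = ∫ x in Ω, inner ℝ (F x) (w x))
    {C q : ℝ} (hC : 0 ≤ C) (hq : 0 < q)
    (hFK : ∀ φ : EuclideanSpace ℝ (Fin N) → ℝ, ContDiff ℝ 1 φ → HasCompactSupport φ →
      tsupport φ ⊆ Ω → ∀ t, 0 < t → t ≤ volume.real Ω + 1 →
      volume (Function.support φ) ≤ ENNReal.ofReal t →
      ∫⁻ x, ‖φ x‖ₑ ≤ ENNReal.ofReal (C * t ^ q) * ∫⁻ x, ‖xGrad X φ x‖ₑ)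
    {k h : ℝ} (hk : 0 ≤ k) (hkh : k < h) :
    (h - k) * (volume.restrict Ω).real {x | h < |u x|} ≤
      4 * C * (α⁻¹ * (eLpNorm F m (volume.restrict Ω)).toReal) ^ (1 / (p - 1)) *
        (volume.restrict Ω).real {x | k < |u x|} ^ (1 + (q - 1 / (m.toReal * (p - 1)))) := by
  have hΩf : IsFiniteMeasure (volume.restrict Ω) := ⟨by simpa using hΩt.lt_top⟩
  set μ := volume.restrict Ω
  set A := μ.real {x | k < |u x|} with hA
  set B := μ.real {x | h < |u x|} with hB
  set K := (α⁻¹ * (eLpNorm F m μ).toReal) ^ (1 / (p - 1)) with hK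
  set τ := 1 - 1 / (m.toReal * (p - 1)) with hτ
  have hp1 : 0 < p - 1 := by linarith
  have hτ0 : 0 ≤ τ := by
    rw [hτ, sub_nonneg]
    rcases eq_or_ne m ∞ with rfl | hmt
    · simp
    · have h1 := (ENNReal.ofReal_le_iff_le_toReal hmt).1 hm
      rw [div_le_iff₀ hp1] at h1
      rw [div_le_one (by linarith)]
      linarith
  have hA0 : 0 ≤ A := measureReal_nonneg
  have hK0 : 0 ≤ K := by positivity
  have hAt : A < volume.real Ω + 1 := by
    have : A ≤ μ.real Set.univ := measureReal_mono (Set.subset_univ _)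
    rw [measureReal_restrict_apply_univ] at this
    linarith
  -- Truncating at the midpoint leaves the gap k < l needed for the approximation. On {|u| > h} it
  -- still gives |H(u)| ≥ (h-k)/4, whence the factor 4.
  obtain ⟨H, hH⟩ := exists_isSmoothTruncation (k := (k + h) / 2) (ε := (h - k) / 4)
    (by linarith) (by linarith)
  have hkl : k < (k + h) / 2 := by linarith
  have hgrad := lintegral_truncation_grad_le hX hp hΩt hα ha hm hF hug hweak hk hkl hH
  have hgrad' : ∫⁻ x in Ω, ‖deriv H (u x) • g x‖ₑ ≤ ENNReal.ofReal (K * A ^ τ) := by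
    refine hgrad.trans_eq ?_
    rw [ENNReal.ofReal_mul hK0, hK, ← ENNReal.ofReal_rpow_of_nonneg (by positivity) (by positivity),
      ← ENNReal.ofReal_rpow_of_nonneg hA0 hτ0, ENNReal.ofReal_mul (by positivity),
      ENNReal.ofReal_toReal hF.2.ne, ENNReal.ofReal_inv_of_pos hα, hA, ofReal_measureReal]
  have hcheb : ENNReal.ofReal ((h - k) / 4 * B) ≤ ∫⁻ x in Ω, ‖H (u x)‖ₑ := by
    rw [ENNReal.ofReal_mul (by linarith), hB, ofReal_measureReal]
    refine le_trans (mul_le_mul_right (measure_mono fun x hx => ?_) _)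
      (mul_meas_ge_le_lintegral₀
        (hH.contDiff.continuous.comp_aestronglyMeasurable hug.1.1).enorm _)
    rw [Set.mem_ofPred_eq, ← ofReal_norm]
    refine ENNReal.ofReal_le_ofReal ?_
    have h1 := hH.sub_le (u x)
    rw [Set.mem_ofPred_eq] at hx
    rw [Real.norm_eq_abs]
    linarith
  -- Faber-Krahn for truncations needs t positive and strictly larger than A, which may be 0; hence
  -- the bound is proved for t > A and t ↓ A. The extra 1 in |Ω| + 1 leaves room above A.
  have hstep : ∀ t ∈ Set.Ioc A (volume.real Ω + 1),
      (h - k) / 4 * B ≤ C * t ^ q * (K * A ^ τ) := by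
    intro t ht
    have ht0 : 0 < t := hA0.trans_lt ht.1
    have h1 := hug.lintegral_truncation_le hX hp hΩt hFK hk hkl hH ht0 ht.2
      ((ENNReal.lt_ofReal_iff_toReal_lt (measure_ne_top _ _)).2 ht.1)
    have h2 := hcheb.trans (h1.trans (mul_le_mul_right hgrad' _))
    rw [← ENNReal.ofReal_mul (by positivity)] at h2
    exact (ENNReal.ofReal_le_ofReal_iff (by positivity)).1 h2
  have hlim : Tendsto (fun t : ℝ => C * t ^ q * (K * A ^ τ)) (𝓝[>] A)
      (𝓝 (C * A ^ q * (K * A ^ τ))) := by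
    have h1 : Tendsto (fun t : ℝ => t ^ q) (𝓝[>] A) (𝓝 (A ^ q)) :=
      (Real.continuousAt_rpow_const A q (Or.inr hq.le)).tendsto.mono_left nhdsWithin_le_nhds
    exact (h1.const_mul C).mul_const _
  have hfin : (h - k) / 4 * B ≤ C * A ^ q * (K * A ^ τ) :=
    ge_of_tendsto hlim (by filter_upwards [Ioc_mem_nhdsGT hAt] with t ht using hstep t ht)
  have hexp : A ^ (1 + (q - 1 / (m.toReal * (p - 1)))) = A ^ q * A ^ τ := by
    rw [← Real.rpow_add_of_nonneg hA0 hq.le hτ0]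
    congr 1
    rw [hτ]
    ring
  rw [hexp]
  linarith

end LevelSets

/-! ### The sup bound. -/

theorem theorem4p3 {N d : ℕ} (hN : 2 ≤ N) (hd : 2 ≤ d)
    (X : Fin d → EuclideanSpace ℝ (Fin N) → EuclideanSpace ℝ (Fin N))
    (hX : ∀ j, LocallyLipschitz (X j))
    (hXtop : CCTopologyEuclidean X)
    (Q : ℝ) (hQ : CCDoubling X Q) (hXP : CCPoincare X)
    (Ω : Set (EuclideanSpace ℝ (Fin N))) (hΩ : IsOpen Ω) (hΩb : Bornology.IsBounded Ω)
    (p : ℝ) (hp : 1 < p) (hpQ : p < Q)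
    (α : ℝ) (hα : 0 < α)
    (m : ℝ≥0∞) (hm : ENNReal.ofReal (Q / (p - 1)) < m) :
    ∃ C : ℝ, 0 < C ∧
      ∀ a : EuclideanSpace ℝ (Fin N) → ℝ → EuclideanSpace ℝ (Fin d) → EuclideanSpace ℝ (Fin d),
        IsLerayLions Ω p α a →
        ∀ F : EuclideanSpace ℝ (Fin N) → EuclideanSpace ℝ (Fin d),
          MemLp F m (volume.restrict Ω) →
          ∀ u : EuclideanSpace ℝ (Fin N) → ℝ, IsWeakSolution X Ω p a F u →
            MemLp u ∞ (volume.restrict Ω) ∧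
            eLpNorm u ∞ (volume.restrict Ω) ≤
              ENNReal.ofReal C * eLpNorm F m (volume.restrict Ω) ^ (1 / (p - 1)) := by
  have hXc : ∀ j, Continuous (X j) := fun j => (hX j).continuous
  have hp1 : 0 < p - 1 := by linarith
  have hQ0 : 0 < Q := by linarith
  have hΩt : volume Ω ≠ ∞ := hΩb.measure_lt_top.ne
  have hΩf : IsFiniteMeasure (volume.restrict Ω) := ⟨by simpa using hΩt.lt_top⟩
  obtain ⟨CF, hCF, hFK⟩ := exists_faberKrahn (by omega) hXc hXtop hQ hQ0 hXP hΩb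
    (volume.real Ω + 1)
  set σ : ℝ := 1 / Q - 1 / (m.toReal * (p - 1)) with hσdef
  have hσ : 0 < σ := by
    rw [hσdef, sub_pos]
    rcases eq_or_ne m ∞ with rfl | hmt
    · simpa using hQ0
    · have h1 := (ENNReal.ofReal_lt_iff_lt_toReal (by positivity) hmt).1 hm
      rw [div_lt_iff₀ hp1] at h1
      exact one_div_lt_one_div_of_lt hQ0 h1
  have hm' : ENNReal.ofReal (p / (p - 1)) ≤ m :=
    (ENNReal.ofReal_le_ofReal (div_le_div_of_nonneg_right hpQ.le hp1.le)).trans hm.le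
  set κ : ℝ := 2 * (4 * CF * α⁻¹ ^ (1 / (p - 1))) * volume.real Ω ^ σ * 2 ^ (1 / σ) with hκ
  have hκ0 : 0 ≤ κ := by positivity
  -- κ vanishes when |Ω| = 0, while the constant has to be positive.
  refine ⟨κ + 1, by positivity, fun a ha F hF u hu => ?_⟩
  obtain ⟨g, hug, hweak⟩ := hu
  set L := (eLpNorm F m (volume.restrict Ω)).toReal with hL
  -- Stampacchia's lemma needs a positive level D, but κ L^(1/(p-1)) may be 0; so D stays arbitrary
  -- here and later decreases to that value.
  have hbound : ∀ D : ℝ, 0 < D → κ * L ^ (1 / (p - 1)) ≤ D →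
      ∀ᵐ x ∂(volume.restrict Ω), ‖u x‖ ≤ D := by
    intro D hD hDκ
    have h0 := stampacchia (f := fun k => (volume.restrict Ω).real {x | k < |u x|})
      (M := 4 * CF * (α⁻¹ * L) ^ (1 / (p - 1))) (A := volume.real Ω) (σ := σ) (D := D)
      (fun k h hkh => measureReal_mono fun x hx => lt_of_le_of_lt hkh hx)
      (fun k => measureReal_nonneg)
      ((measureReal_mono (Set.subset_univ _)).trans_eq (measureReal_restrict_apply_univ Ω))
      (by positivity) hσ hD
      (fun k h hk hkh => sub_mul_measureReal_level_le hXc hp hΩt hα ha hm' hF hug hweak hCF.le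
        (by positivity) hFK hk hkh)
      (by
        refine le_of_eq_of_le ?_ hDκ
        rw [Real.mul_rpow (by positivity) ENNReal.toReal_nonneg, hκ]
        ring)
    rw [measureReal_eq_zero_iff] at h0
    rw [ae_iff]
    simpa using h0
  have hle : eLpNorm u ∞ (volume.restrict Ω) ≤ ENNReal.ofReal (κ * L ^ (1 / (p - 1))) := by
    have hlim : Tendsto (fun D : ℝ => ENNReal.ofReal D) (𝓝[>] (κ * L ^ (1 / (p - 1))))
        (𝓝 (ENNReal.ofReal (κ * L ^ (1 / (p - 1))))) :=
      (ENNReal.continuous_ofReal.tendsto _).mono_left nhdsWithin_le_nhds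
    refine ge_of_tendsto hlim ?_
    filter_upwards [self_mem_nhdsWithin] with D hD
    rw [eLpNorm_exponent_top]
    exact eLpNormEssSup_le_of_ae_bound
      (hbound D ((by positivity : 0 ≤ κ * L ^ (1 / (p - 1))).trans_lt hD) (le_of_lt hD))
  refine ⟨⟨hug.1.1, hle.trans_lt ENNReal.ofReal_lt_top⟩, hle.trans ?_⟩
  rw [ENNReal.ofReal_mul hκ0, ← ENNReal.ofReal_rpow_of_nonneg ENNReal.toReal_nonneg
    (by positivity), ENNReal.ofReal_toReal hF.2.ne]
  gcongr
  linarith
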